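/- Let $f$ be a complex-valued function (for instance a real-valued one) that is locally integrable on $[0,\infty)$ and continuously differentiable on $(0,\infty)$. Let $Q=\{z:\operatorname{Re}z>0,\ \operatorname{Im}z>0\}$ and suppose that $f$ has an analytic continuation to $Q$, again denoted by $f$: it is holomorphic in $Q$ and $f(z)\to f(t)$ as $z\to t$, $z\in Q$, for every $t>0$. Suppose that the origin is at most a singularity (for instance a branch point) of algebraic type, in the sense that $f(z)=O(|z|^{-K})$ as $z\to0$ in $Q$ for some $K\in\mathbb R$, and that there are constants $M>0$, $\delta<1$ and $d\ge 0$ with $$|f(z)|\le M|z|^{\delta}e^{d\,\operatorname{Im}z}$$ for all $z\in Q$ of sufficiently large modulus. Suppose finally that $f$ has the asymptotic expansion $$f(t)\sim\sum_{j=0}^{\infty}a_jt^{\,j-\alpha}\qquad(t\to0^+),\qquad 0\le\alpha<1,$$ that is, $f(t)-\sum_{j=0}^{N}a_jt^{\,j-\alpha}=o(t^{N-\alpha})$ as $t\to 0^+$ for every $N\ge0$. Let $x>0$ be fixed. Then for every $\omega>d$ the one-sided oscillatory Hilbert transform $$H^+(f(t)e^{i\omega t})(x)=\lim_{\varepsilon\to0^+}\left(\int_0^{x-\varepsilon}+\int_{x+\varepsilon}^{\infty}\right)e^{i\omega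 t}\frac{f(t)}{t-x}\,dt$$ exists (a Cauchy principal value at $x$, and an improper integral at infinity), and $$H^+(f(t)e^{i\omega t})(x)\sim i\pi e^{i\omega x}f(x)-\sum_{\ell=0}^{\infty}\frac{\Gamma(\ell+1-\alpha)}{\omega^{\ell+1-\alpha}}\,e^{\frac{\pi}{2}(\ell+1-\alpha)i}\left(\sum_{j+k=\ell}\frac{a_j}{x^{k+1}}\right)\qquad(\omega\to\infty),$$ that is, for every $N\ge0$ the difference between the left-hand side and the sum of $i\pi e^{i\omega x}f(x)$ and the terms with $0\le\ell\le N$ is $o(\omega^{-(N+1-\alpha)})$ as $\omega\to\infty$. -/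

import Mathlib

open Filter Topology Asymptotics MeasureTheory Set

/-- The open first quadrant of the complex plane. -/
def firstQuadrant : Set ℂ := {z : ℂ | 0 < z.re ∧ 0 < z.im}

/-- The function `g` has the (Poincaré) asymptotic expansion `g ~ ∑ c j * φ j` along the filter `l`
with respect to the asymptotic scale `φ 0, φ 1, φ 2, …`: for every `N` the remainder after the
`N`-th term is `o (φ N)`. -/
def HasAsymptoticExpansion (g : ℝ → ℂ) (c : ℕ → ℂ) (φ : ℕ → ℝ → ℝ) (l : Filter ℝ) : Prop :=
  ∀ N : ℕ, (fun s => g s - ∑ j ∈ Finset.range (N + 1), c j * (φ j s : ℂ)) =o[l] φ N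

/-- `F` is an analytic continuation of `f : (0, ∞) → ℂ` into the open first quadrant: `F` is
holomorphic there and takes the value `f t` (as a limit from the quadrant) at every `t > 0`. -/
def IsContinuationToFirstQuadrant (F : ℂ → ℂ) (f : ℝ → ℂ) : Prop :=
  DifferentiableOn ℂ F firstQuadrant ∧
    ∀ t : ℝ, 0 < t → Tendsto F (𝓝[firstQuadrant] (t : ℂ)) (𝓝 (f t))

/-- The singularity of `F` at the origin (a branch point, possibly) is of algebraic type: in the
first quadrant `F` grows at most like a power of `1 / |z|` as `z → 0`. -/
def HasAlgebraicGrowthAtOrigin (F : ℂ → ℂ) : Prop :=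
  ∃ K : ℝ, F =O[𝓝[firstQuadrant] 0] fun z => ‖z‖ ^ (-K)

/-- The truncated integral `(∫₀^{x-ε} + ∫_{x+ε}^R) g(t) / (t - x) dt`, with `p = (ε, R)`. -/
noncomputable def truncatedHilbert (g : ℝ → ℂ) (x : ℝ) (p : ℝ × ℝ) : ℂ :=
  (∫ t in (0 : ℝ)..(x - p.1), g t / ((t : ℂ) - (x : ℂ))) +
    ∫ t in (x + p.1)..p.2, g t / ((t : ℂ) - (x : ℂ))

/-- The one-sided Hilbert transform `⨍₀^∞ g(t) / (t - x) dt` exists and equals `L`, as a Cauchy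
principal value at `x` and as an improper integral at infinity (the dependence of the truncated
integral on `ε → 0⁺` and on `R → ∞` is additively separated, so the joint limit and the iterated
limits agree). -/
def HasOneSidedHilbert (g : ℝ → ℂ) (x : ℝ) (L : ℂ) : Prop :=
  Tendsto (truncatedHilbert g x) (𝓝[>] (0 : ℝ) ×ˢ atTop) (𝓝 L)

/-- The value `H⁺(g)(x)` of the one-sided Hilbert transform (meaningful when it exists). -/
noncomputable def oneSidedHilbert (g : ℝ → ℂ) (x : ℝ) : ℂ :=
  limUnder (𝓝[>] (0 : ℝ) ×ˢ atTop) (truncatedHilbert g x)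

/-- The function `t ↦ f(t) e^{iωt}`. -/
noncomputable def oscillatory (f : ℝ → ℂ) (ω : ℝ) : ℝ → ℂ :=
  fun t => f t * Complex.exp (Complex.I * (ω : ℂ) * (t : ℂ))

/-!
The contour of the Hilbert transform is rotated from the positive real axis to the ray
`arg z = π / 6`, where `e ^ (iωz)` decays like `e ^ (-ω |z| / 2)`, and Watson's lemma is
applied there.

*Rotation.* The integrand `F(z) e ^ (iωz) / (z - x)` has a primitive on the (convex) quadrant, and
`exists_boundary_primitive` extends it to the positive real axis without the point `x`, so that
integrals along the axis, the ray, and circular arcs are all differences of its values. A half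
circle of radius `ε` around `x` contributes `iπ e ^ (iωx) f(x)` in the limit, because `F` is
continuous up to the axis. The arc from the axis to the ray of large radius vanishes by Jordan's
lemma (this uses `δ < 1` and `ω > d`), and the one of small radius because `F = O(|z| ^ (-α))` in
the sector. Hence the transform exists and equals the half residue plus an absolutely convergent
integral over the ray, see `hasOneSidedHilbert_ray`.

*Expansion in the sector.* The expansion of `f` at the origin is given on the real axis only. By the
Phragmén–Lindelöf principle in the variable `log z`, a function that is `O(|z| ^ (-K))` in the
sector `0 ≤ arg z ≤ θ` and `O(t ^ B)` on the real axis is, on the ray of angle `v`, bounded by the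
power of `|z|` whose exponent interpolates linearly between `B` and `-K` (`norm_le_of_sector`).
As `B` may be taken arbitrarily large, by subtracting many terms of the expansion, the expansion
holds in the sector `0 ≤ arg z ≤ π / 6`, with global remainder bounds `C |z| ^ (N + 1 - α) e ^ (D |z|)`, see
`exists_remainder_bound`.

*Watson's lemma.* With `c l = ∑_{j + k = l} a j / x ^ (k + 1)`, multiplication by `z - x` telescopes
`∑ c l z ^ l`, so that the integrand on the ray is `-∑ c l z ^ (l - α) e ^ (iωz)` up to a remainder
controlled by the previous step. The powers are integrated by the Gamma integral with complex
parameter, `integral_rpow_mul_cexp_neg_mul`, and the remainder is `O(ω ^ (-(N + 2 - α)))`.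
-/

/-! ### Path integrals along the boundary of the quadrant -/

theorem convex_firstQuadrant : Convex ℝ firstQuadrant :=
  (convex_halfSpace_re_gt 0).inter (convex_halfSpace_im_gt 0)

theorem isOpen_firstQuadrant : IsOpen firstQuadrant :=
  (isOpen_lt continuous_const Complex.continuous_re).inter
    (isOpen_lt continuous_const Complex.continuous_im)

theorem tendsto_integral_of_continuousOn_prod {H : ℝ × ℝ → ℂ} {a b c : ℝ} (hab : a ≤ b)
    (hc : 0 < c) (hH : ContinuousOn H (Icc a b ×ˢ Icc 0 c)) :
    Tendsto (fun η : ℝ => ∫ s in a..b, H (s, η)) (𝓝[>] 0) (𝓝 (∫ s in a..b, H (s, 0))) := by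
  obtain ⟨C, hC⟩ := (isCompact_Icc.prod isCompact_Icc).exists_bound_of_continuousOn hH
  have hev : ∀ᶠ η : ℝ in 𝓝[>] 0, η ∈ Icc (0 : ℝ) c := by
    filter_upwards [Ioo_mem_nhdsGT hc] with η hη
    exact ⟨hη.1.le, hη.2.le⟩
  refine intervalIntegral.tendsto_integral_filter_of_dominated_convergence (fun _ => C) ?_ ?_
    (by simp) ?_
  · filter_upwards [hev] with η hη
    rw [uIoc_of_le hab]
    refine ContinuousOn.aestronglyMeasurable ?_ measurableSet_Ioc
    exact (hH.comp (f := fun s : ℝ => (s, η)) (by fun_prop)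
      (fun s hs => ⟨hs, hη⟩)).mono Ioc_subset_Icc_self
  · filter_upwards [hev] with η hη
    refine Eventually.of_forall fun s hs => ?_
    rw [uIoc_of_le hab] at hs
    exact hC (s, η) ⟨Ioc_subset_Icc_self hs, hη⟩
  · refine Eventually.of_forall fun s hs => ?_
    rw [uIoc_of_le hab] at hs
    have hs' := Ioc_subset_Icc_self hs
    have h0 : ((s, 0) : ℝ × ℝ) ∈ Icc a b ×ˢ Icc (0 : ℝ) c := ⟨hs', ⟨le_rfl, hc.le⟩⟩
    exact (hH _ h0).tendsto.comp (f := fun η : ℝ => (s, η)) (x := 𝓝[>] 0)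
      (tendsto_nhdsWithin_iff.2
        ⟨((by fun_prop : Continuous fun η : ℝ => (s, η)).tendsto 0).mono_left nhdsWithin_le_nhds,
          hev.mono fun η hη => ⟨hs', hη⟩⟩)

/-- Integrals over a path in `D` are limits of integrals over the path pushed upwards. -/
theorem tendsto_integral_shift {g : ℂ → ℂ} {D : Set ℂ} (hg : ContinuousOn g D)
    (hD : ∀ z ∈ D, ∀ η : ℝ, 0 ≤ η → z + η * Complex.I ∈ D)
    {γ γ' : ℝ → ℂ} (hγ : Continuous γ) (hγ' : Continuous γ') {a b : ℝ} (hab : a ≤ b)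
    (hmem : ∀ s ∈ Icc a b, γ s ∈ D) :
    Tendsto (fun η : ℝ => ∫ s in a..b, g (γ s + η * Complex.I) * γ' s) (𝓝[>] 0)
      (𝓝 (∫ s in a..b, g (γ s) * γ' s)) := by
  have hmaps : MapsTo (fun p : ℝ × ℝ => γ p.1 + p.2 * Complex.I) (Icc a b ×ˢ Icc 0 1) D :=
    fun p hp => hD _ (hmem _ hp.1) _ hp.2.1
  have := tendsto_integral_of_continuousOn_prod hab one_pos
    (H := fun p : ℝ × ℝ => g (γ p.1 + p.2 * Complex.I) * γ' p.1)
    ((hg.comp (by fun_prop) hmaps).mul (by fun_prop))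
  simpa using this

/-- A function that is holomorphic in the quadrant and continuous up to a part of its boundary
has a primitive there, in the sense that path integrals only depend on the end points of the path,
even if the path touches the boundary. -/
theorem exists_boundary_primitive {g : ℂ → ℂ} {D : Set ℂ}
    (hgQ : DifferentiableOn ℂ g firstQuadrant) (hg : ContinuousOn g D)
    (hQD : firstQuadrant ⊆ D) (hD : ∀ z ∈ D, 0 < z.re ∧ 0 ≤ z.im) :
    ∃ P : ℂ → ℂ, ∀ γ γ' : ℝ → ℂ, (∀ s, HasDerivAt γ (γ' s) s) → Continuous γ' →
      ∀ a b : ℝ, a ≤ b → (∀ s ∈ Icc a b, γ s ∈ D) →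
        ∫ s in a..b, g (γ s) * γ' s = P (γ b) - P (γ a) := by
  have hup : ∀ z ∈ D, ∀ η : ℝ, 0 < η → z + η * Complex.I ∈ firstQuadrant := by
    intro z hz η hη
    have := hD z hz
    constructor <;> simp <;> linarith
  have hup' : ∀ z ∈ D, ∀ η : ℝ, 0 ≤ η → z + η * Complex.I ∈ D := by
    intro z hz η hη
    rcases hη.eq_or_lt with rfl | h
    · simpa using hz
    · exact hQD (hup z hz η h)
  obtain ⟨P, hP⟩ := convex_firstQuadrant.exists_forall_hasDerivWithinAt hgQ
  have hP' : ∀ z ∈ firstQuadrant, HasDerivAt P (g z) z := fun z hz =>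
    (hP z hz).hasDerivAt (isOpen_firstQuadrant.mem_nhds hz)
  -- the fundamental theorem of calculus for paths pushed into the open quadrant
  have key : ∀ γ γ' : ℝ → ℂ, (∀ s, HasDerivAt γ (γ' s) s) → Continuous γ' →
      ∀ a b : ℝ, a ≤ b → (∀ s ∈ Icc a b, γ s ∈ D) → ∀ η : ℝ, 0 < η →
        ∫ s in a..b, g (γ s + η * Complex.I) * γ' s =
          P (γ b + η * Complex.I) - P (γ a + η * Complex.I) := by
    intro γ γ' hγ hγ' a b hab hmem η hη
    have hγc : Continuous γ := continuous_iff_continuousAt.2 fun s => (hγ s).continuousAt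
    refine intervalIntegral.integral_eq_sub_of_hasDerivAt
      (f := fun s => P (γ s + η * Complex.I)) ?_ ?_
    · intro s hs
      rw [uIcc_of_le hab] at hs
      exact (hP' _ (hup _ (hmem s hs) η hη)).comp s ((hγ s).add_const _)
    · refine ContinuousOn.intervalIntegrable ?_
      rw [uIcc_of_le hab]
      exact (hg.comp (by fun_prop) fun s hs => hup' _ (hmem s hs) η hη.le).mul hγ'.continuousOn
  -- the boundary values of `P`, expressed by an integral over a vertical segment, which may start
  -- on the boundary
  set Pb : ℂ → ℂ := fun z => P (z + Complex.I) -
    ∫ s in (0 : ℝ)..1, g (z + s * Complex.I) * Complex.I with hPb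
  have hlim : ∀ z ∈ D, Tendsto (fun η : ℝ => P (z + η * Complex.I)) (𝓝[>] 0) (𝓝 (Pb z)) := by
    intro z hz
    have hd : ∀ s : ℝ, HasDerivAt (fun s : ℝ => z + s * Complex.I) Complex.I s := by
      intro s
      simpa using ((Complex.ofRealCLM.hasDerivAt (x := s)).mul_const Complex.I).const_add z
    have hmem : ∀ s ∈ Icc (0 : ℝ) 1, z + s * Complex.I ∈ D := fun s hs => hup' z hz s hs.1
    have h1 := tendsto_integral_shift hg hup' (γ := fun s : ℝ => z + s * Complex.I)
      (γ' := fun _ => Complex.I) (by fun_prop) (by fun_prop) zero_le_one hmem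
    have hzI : z + Complex.I ∈ firstQuadrant := by simpa using hup z hz 1 one_pos
    have h2 : Tendsto (fun η : ℝ => P (z + Complex.I + η * Complex.I)) (𝓝[>] 0)
        (𝓝 (P (z + Complex.I))) := by
      have hc : Tendsto (fun η : ℝ => z + Complex.I + η * Complex.I) (𝓝[>] 0)
          (𝓝 (z + Complex.I)) := by
        have : Continuous fun η : ℝ => z + Complex.I + η * Complex.I := by fun_prop
        simpa using (this.tendsto 0).mono_left nhdsWithin_le_nhds
      exact (hP' _ hzI).continuousAt.tendsto.comp hc
    refine (h2.sub h1).congr' ?_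
    filter_upwards [self_mem_nhdsWithin] with η hη
    rw [key _ _ hd continuous_const 0 1 zero_le_one hmem η hη]
    simp
  refine ⟨Pb, fun γ γ' hγ hγ' a b hab hmem => ?_⟩
  have hγc : Continuous γ := continuous_iff_continuousAt.2 fun s => (hγ s).continuousAt
  refine tendsto_nhds_unique (tendsto_integral_shift hg hup' hγc hγ' hab hmem) ?_
  refine ((hlim _ (hmem b (right_mem_Icc.2 hab))).sub
    (hlim _ (hmem a (left_mem_Icc.2 hab)))).congr' ?_
  filter_upwards [self_mem_nhdsWithin] with η hη
  exact (key γ γ' hγ hγ' a b hab hmem η hη).symm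

/-! ### The continuation up to the positive real axis -/

/-- The first quadrant together with the open positive real axis. -/
def rightQuadrant : Set ℂ := {z : ℂ | 0 < z.re ∧ 0 ≤ z.im}

/-- The function `F` on the quadrant, extended to the positive real axis by its boundary
values `f`. -/
noncomputable def boundaryExtension (F : ℂ → ℂ) (f : ℝ → ℂ) (z : ℂ) : ℂ :=
  open Classical in if 0 < z.im then F z else f z.re

theorem boundaryExtension_of_mem {F : ℂ → ℂ} {f : ℝ → ℂ} {z : ℂ} (hz : z ∈ firstQuadrant) :
    boundaryExtension F f z = F z := if_pos hz.2

theorem boundaryExtension_ofReal (F : ℂ → ℂ) (f : ℝ → ℂ) (t : ℝ) :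
    boundaryExtension F f t = f t := by simp [boundaryExtension]

theorem firstQuadrant_subset_rightQuadrant : firstQuadrant ⊆ rightQuadrant :=
  fun _ hz => ⟨hz.1, hz.2.le⟩

theorem rightQuadrant_subset_slitPlane : rightQuadrant ⊆ Complex.slitPlane :=
  fun _ hz => Or.inl hz.1

theorem mem_firstQuadrant_or_eq_ofReal {z : ℂ} (hz : z ∈ rightQuadrant) :
    z ∈ firstQuadrant ∨ ∃ t : ℝ, 0 < t ∧ z = t := by
  rcases hz.2.eq_or_lt with h | h
  · exact Or.inr ⟨z.re, hz.1, Complex.ext rfl (by simpa using h.symm)⟩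
  · exact Or.inl ⟨hz.1, h⟩

theorem exp_mem_rightQuadrant {ζ : ℂ} (h0 : 0 ≤ ζ.im) (h1 : ζ.im < Real.pi / 2) :
    Complex.exp ζ ∈ rightQuadrant := by
  refine ⟨?_, ?_⟩
  · rw [Complex.exp_re]
    exact mul_pos (Real.exp_pos _) (Real.cos_pos_of_mem_Ioo ⟨by linarith [Real.pi_pos], h1⟩)
  · rw [Complex.exp_im]
    exact mul_nonneg (Real.exp_pos _).le
      (Real.sin_nonneg_of_nonneg_of_le_pi h0 (by linarith [Real.pi_pos]))

theorem exp_mem_firstQuadrant {ζ : ℂ} (h0 : 0 < ζ.im) (h1 : ζ.im < Real.pi / 2) :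
    Complex.exp ζ ∈ firstQuadrant := by
  refine ⟨(exp_mem_rightQuadrant h0.le h1).1, ?_⟩
  rw [Complex.exp_im]
  exact mul_pos (Real.exp_pos _) (Real.sin_pos_of_pos_of_lt_pi h0 (by linarith [Real.pi_pos]))

theorem nhdsWithin_firstQuadrant_neBot {t : ℝ} (ht : 0 < t) :
    (𝓝[firstQuadrant] (t : ℂ)).NeBot := by
  rw [← mem_closure_iff_nhdsWithin_neBot]
  have hc : Tendsto (fun η : ℝ => (t : ℂ) + η * Complex.I) (𝓝[>] 0) (𝓝 (t : ℂ)) := by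
    have : Continuous fun η : ℝ => (t : ℂ) + η * Complex.I := by fun_prop
    simpa using (this.tendsto 0).mono_left nhdsWithin_le_nhds
  refine mem_closure_of_tendsto hc ?_
  filter_upwards [self_mem_nhdsWithin] with η hη
  constructor <;> simpa

section Extension

variable {F : ℂ → ℂ} {f : ℝ → ℂ}

theorem differentiableOn_boundaryExtension (hF : IsContinuationToFirstQuadrant F f) :
    DifferentiableOn ℂ (boundaryExtension F f) firstQuadrant :=
  hF.1.congr fun _ hz => boundaryExtension_of_mem hz

theorem continuousOn_boundaryExtension (hf : ContinuousOn f (Ioi 0))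
    (hF : IsContinuationToFirstQuadrant F f) :
    ContinuousOn (boundaryExtension F f) rightQuadrant := by
  intro z hz
  rcases mem_firstQuadrant_or_eq_ofReal hz with hz | ⟨t, ht, rfl⟩
  · exact ((differentiableOn_boundaryExtension hF).differentiableAt
      (isOpen_firstQuadrant.mem_nhds hz)).continuousAt.continuousWithinAt
  · have hsub : rightQuadrant ⊆ firstQuadrant ∪ {z : ℂ | z.im = 0 ∧ 0 < z.re} := by
      intro w hw
      rcases hw.2.eq_or_lt with h | h
      · exact Or.inr ⟨h.symm, hw.1⟩
      · exact Or.inl ⟨hw.1, h⟩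
    refine ContinuousWithinAt.mono (ContinuousWithinAt.union ?_ ?_) hsub
    · rw [ContinuousWithinAt, boundaryExtension_ofReal]
      refine (hF.2 t ht).congr' ?_
      filter_upwards [self_mem_nhdsWithin] with w hw
      exact (boundaryExtension_of_mem hw).symm
    · have hc : ContinuousAt (fun w : ℂ => f w.re) (t : ℂ) := by
        have : ContinuousAt f ((t : ℂ).re) := by
          simpa using hf.continuousAt (Ioi_mem_nhds ht)
        exact this.comp Complex.continuous_re.continuousAt
      refine hc.continuousWithinAt.congr (fun w hw => ?_) (by simp [boundaryExtension])
      simp [boundaryExtension, hw.1]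

/-- A bound for `F` in an open part of the quadrant passes to the boundary values. -/
theorem norm_boundaryExtension_le (hF : IsContinuationToFirstQuadrant F f) {U : Set ℂ}
    (hU : IsOpen U) {ψ : ℂ → ℝ} (hψ : ∀ z ∈ rightQuadrant, ContinuousAt ψ z)
    (h : ∀ z ∈ firstQuadrant, z ∈ U → ‖F z‖ ≤ ψ z) {z : ℂ} (hz : z ∈ rightQuadrant)
    (hzU : z ∈ U) : ‖boundaryExtension F f z‖ ≤ ψ z := by
  rcases mem_firstQuadrant_or_eq_ofReal hz with hz' | ⟨t, ht, rfl⟩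
  · rw [boundaryExtension_of_mem hz']
    exact h z hz' hzU
  · rw [boundaryExtension_ofReal]
    have := nhdsWithin_firstQuadrant_neBot ht
    refine le_of_tendsto_of_tendsto (hF.2 t ht).norm
      ((hψ _ hz).tendsto.mono_left nhdsWithin_le_nhds) ?_
    filter_upwards [self_mem_nhdsWithin, nhdsWithin_le_nhds (hU.mem_nhds hzU)] with w hw hwU
    exact h w hw hwU

end Extension

/-! ### A Phragmén–Lindelöf estimate in a sector -/

/-- In a bound `exp (p u + D e ^ u)`, i.e. `r ^ p e ^ (D r)` with `r = e ^ u`, the exponent `p` may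
be lowered at the expense of `D`. -/
theorem exp_add_mul_exp_mono {p q D D' : ℝ} (hqp : q ≤ p) (hD : D + (p - q) ≤ D') (u : ℝ) :
    Real.exp (p * u + D * Real.exp u) ≤ Real.exp (q * u + D' * Real.exp u) := by
  apply Real.exp_le_exp.2
  have h1 : u ≤ Real.exp u := by linarith [Real.add_one_le_exp u]
  nlinarith [mul_le_mul_of_nonneg_left h1 (sub_nonneg.2 hqp),
    mul_le_mul_of_nonneg_right hD (Real.exp_pos u).le]

/-- A function of `r ^ (-K)` growth in a sector that is `O (r ^ B)` on one of its sides is bounded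
by the power of `r` that interpolates linearly between these two, up to a factor `e ^ (D' r)`. In
the variable `ζ = log z`, the factor `exp (-B ζ + i c ζ ^ 2)`, with `c = -(K + B) / (2 θ)`, turns
both sides into bounded ones, and `exp (-D' exp ζ)` removes the exponential growth at infinity. -/
theorem norm_le_of_sector {G : ℂ → ℂ} {θ C K D B : ℝ} (hθ : 0 < θ) (hθ' : θ < Real.pi / 2)
    (hGd : DifferentiableOn ℂ G firstQuadrant) (hGc : ContinuousOn G rightQuadrant)
    (hK : 0 ≤ K) (hB : 0 ≤ B) (hD : 0 ≤ D)
    (hG : ∀ ζ : ℂ, 0 ≤ ζ.im → ζ.im ≤ θ →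
      ‖G (Complex.exp ζ)‖ ≤ C * Real.exp (-K * ζ.re + D * Real.exp ζ.re))
    (hreal : ∀ u : ℝ, ‖G (Complex.exp u)‖ ≤ C * Real.exp (B * u + D * Real.exp u))
    {ζ : ℂ} (h0 : 0 ≤ ζ.im) (h1 : ζ.im ≤ θ) :
    ‖G (Complex.exp ζ)‖ ≤
      C * Real.exp ((B - (K + B) * (ζ.im / θ)) * ζ.re + D / Real.cos θ * Real.exp ζ.re) := by
  have hcos : 0 < Real.cos θ := Real.cos_pos_of_mem_Ioo ⟨by linarith, hθ'⟩
  have hC : 0 ≤ C := nonneg_of_mul_nonneg_left ((norm_nonneg _).trans (hreal 0)) (Real.exp_pos _)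
  set D' := D / Real.cos θ with hD'
  have hD'D : D' * Real.cos θ = D := by rw [hD']; field_simp
  have hD'0 : 0 ≤ D' := by positivity
  set c : ℝ := -((K + B) / (2 * θ)) with hc
  set E : ℂ → ℂ := fun w => -(D' * Complex.exp w) - B * w + Complex.I * c * w ^ 2 with hE
  have hEre : ∀ w : ℂ, (E w).re =
      -(D' * Real.exp w.re * Real.cos w.im) - B * w.re + (K + B) * (w.im / θ) * w.re := by
    intro w
    simp only [hE, pow_two]
    simp [Complex.exp_re, Complex.exp_im]
    rw [hc]
    field_simp
    ring
  have hcosle : ∀ w : ℂ, 0 ≤ w.im → w.im ≤ θ → D ≤ D' * Real.cos w.im := by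
    intro w hw0 hw1
    rw [← hD'D]
    exact mul_le_mul_of_nonneg_left
      (Real.cos_le_cos_of_nonneg_of_le_pi hw0 (by linarith [Real.pi_pos]) hw1) hD'0
  set Ψ : ℂ → ℂ := fun w => G (Complex.exp w) * Complex.exp (E w) with hΨ
  have hnorm : ∀ w, ‖Ψ w‖ = ‖G (Complex.exp w)‖ * Real.exp (E w).re := by
    intro w
    rw [hΨ, norm_mul, Complex.norm_exp]
  -- a bound for `Ψ` from an exponential bound for `G` on the strip
  have hbound : ∀ (w : ℂ) (p : ℝ), 0 ≤ w.im → w.im ≤ θ →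
      ‖G (Complex.exp w)‖ ≤ C * Real.exp (p * w.re + D * Real.exp w.re) →
      ‖Ψ w‖ ≤ C * Real.exp ((p - B + (K + B) * (w.im / θ)) * w.re) := by
    intro w p hw0 hw1 hw
    rw [hnorm]
    refine (mul_le_mul_of_nonneg_right hw (Real.exp_pos _).le).trans ?_
    rw [mul_assoc, ← Real.exp_add, hEre]
    refine mul_le_mul_of_nonneg_left (Real.exp_le_exp.2 ?_) hC
    nlinarith [mul_le_mul_of_nonneg_right (hcosle w hw0 hw1) (Real.exp_pos w.re).le]
  have hEd : Differentiable ℂ E := by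
    simp only [hE]; fun_prop
  have hcl : closure (Complex.im ⁻¹' Ioo 0 θ) ⊆ Complex.im ⁻¹' Icc 0 θ :=
    closure_minimal (preimage_mono Ioo_subset_Icc_self)
      (isClosed_Icc.preimage Complex.continuous_im)
  have hfd : DiffContOnCl ℂ Ψ (Complex.im ⁻¹' Ioo 0 θ) := by
    constructor
    · refine DifferentiableOn.mul ?_ hEd.cexp.differentiableOn
      exact hGd.comp Complex.differentiable_exp.differentiableOn
        fun w hw => exp_mem_firstQuadrant hw.1 (hw.2.trans hθ')
    · refine ContinuousOn.mul ?_ hEd.cexp.continuous.continuousOn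
      exact hGc.comp Complex.continuous_exp.continuousOn
        fun w hw => exp_mem_rightQuadrant (hcl hw).1 ((hcl hw).2.trans_lt hθ')
  have hmain : ‖Ψ ζ‖ ≤ C := by
    refine PhragmenLindelof.horizontal_strip hfd ⟨1, ?_, K + B, ?_⟩ ?_ ?_ h0 h1
    · rw [sub_zero, lt_div_iff₀ hθ]
      linarith [Real.pi_pos]
    · refine IsBigO.of_bound C ?_
      refine eventually_inf_principal.2 (Eventually.of_forall fun w hw => ?_)
      refine (hbound w (-K) hw.1.le hw.2.le (hG w hw.1.le hw.2.le)).trans ?_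
      rw [Real.norm_of_nonneg (Real.exp_pos _).le]
      refine mul_le_mul_of_nonneg_left (Real.exp_le_exp.2 ?_) hC
      have hv0 : 0 ≤ w.im / θ := div_nonneg hw.1.le hθ.le
      have hv1 : w.im / θ ≤ 1 := (div_le_one hθ).2 hw.2.le
      have hu : |w.re| ≤ Real.exp (1 * |w.re|) := by
        rw [one_mul]; linarith [Real.add_one_le_exp |w.re|]
      calc (-K - B + (K + B) * (w.im / θ)) * w.re = (K + B) * ((1 - w.im / θ) * -w.re) := by ring
        _ ≤ (K + B) * (1 * |w.re|) := by
          refine mul_le_mul_of_nonneg_left ?_ (by positivity)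
          calc (1 - w.im / θ) * -w.re ≤ (1 - w.im / θ) * |w.re| :=
                mul_le_mul_of_nonneg_left (neg_le_abs _) (by linarith)
            _ ≤ 1 * |w.re| := mul_le_mul_of_nonneg_right (by linarith) (abs_nonneg _)
        _ ≤ (K + B) * Real.exp (1 * |w.re|) := by
          simpa only [one_mul] using mul_le_mul_of_nonneg_left hu (by positivity)
    · intro w hw
      have hw' : w = (w.re : ℂ) := Complex.ext rfl (by simpa using hw)
      refine (hbound w B hw.ge (by linarith) ?_).trans (by simp [hw])
      have := hreal w.re
      rwa [← hw'] at this
    · intro w hw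
      refine (hbound w (-K) (by linarith) hw.le (hG w (by linarith) hw.le)).trans ?_
      rw [hw, div_self hθ.ne']
      simp
  rw [hnorm, hEre] at hmain
  have h2 := mul_le_mul_of_nonneg_right hmain (Real.exp_pos
    (D' * Real.exp ζ.re * Real.cos ζ.im + B * ζ.re - (K + B) * (ζ.im / θ) * ζ.re)).le
  rw [mul_assoc, ← Real.exp_add] at h2
  have h3 : -(D' * Real.exp ζ.re * Real.cos ζ.im) - B * ζ.re + (K + B) * (ζ.im / θ) * ζ.re +
      (D' * Real.exp ζ.re * Real.cos ζ.im + B * ζ.re - (K + B) * (ζ.im / θ) * ζ.re) = 0 := by ring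
  rw [h3, Real.exp_zero, mul_one] at h2
  refine h2.trans (mul_le_mul_of_nonneg_left (Real.exp_le_exp.2 ?_) hC)
  have : D' * Real.exp ζ.re * Real.cos ζ.im ≤ D' * Real.exp ζ.re * 1 :=
    mul_le_mul_of_nonneg_left (Real.cos_le_one _) (by positivity)
  linarith

/-! ### The Gamma integral with a complex parameter -/

/-- The Gamma integral `∫ t ^ (a - 1) e ^ (-r t) dt = r ^ (-a) Γ(a)` for complex `r` in the right
half plane: both sides are analytic in `r` and agree on the positive reals. -/
theorem integral_rpow_mul_cexp_neg_mul {a : ℝ} (ha : 0 < a) {r : ℂ} (hr : 0 < r.re) :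
    ∫ t in Ioi (0 : ℝ), ((t ^ (a - 1) : ℝ) : ℂ) * Complex.exp (-(r * t)) =
      r ^ (-(a : ℂ)) * Real.Gamma a := by
  set w : ℝ → NNReal := fun t => (t ^ (a - 1)).toNNReal with hw
  have hwm : Measurable w := by simp only [hw]; fun_prop
  set μ : Measure ℝ := (volume.restrict (Ioi 0)).withDensity fun t => (w t : ENNReal) with hμ
  have hmgf : ∀ z : ℂ, ProbabilityTheory.complexMGF id μ z =
      ∫ t in Ioi (0 : ℝ), ((t ^ (a - 1) : ℝ) : ℂ) * Complex.exp (z * t) := by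
    intro z
    rw [ProbabilityTheory.complexMGF, hμ, integral_withDensity_eq_integral_smul hwm]
    refine setIntegral_congr_fun measurableSet_Ioi fun t ht => ?_
    have : ((w t : ℝ) : ℂ) = ((t ^ (a - 1) : ℝ) : ℂ) := by
      rw [hw, Real.coe_toNNReal _ (Real.rpow_nonneg (le_of_lt ht) _)]
    simp only [id, NNReal.smul_def, Complex.real_smul, this]
  have hset : Iio 0 ⊆ ProbabilityTheory.integrableExpSet id μ := by
    intro b hb
    rw [ProbabilityTheory.integrableExpSet, mem_ofPred_eq, hμ,
      integrable_withDensity_iff_integrable_smul hwm]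
    have h := integrableOn_rpow_mul_exp_neg_mul_rpow (p := 1) (s := a - 1) (b := -b)
      (by linarith) one_pos (by simpa using hb)
    refine h.congr_fun (fun t ht => ?_) measurableSet_Ioi
    simp only [id, NNReal.smul_def, hw, smul_eq_mul, Real.rpow_one, neg_neg]
    rw [Real.coe_toNNReal _ (Real.rpow_nonneg (le_of_lt ht) _)]
  have hint : {z : ℂ | z.re < 0} ⊆
      {z : ℂ | z.re ∈ interior (ProbabilityTheory.integrableExpSet id μ)} := fun z hz =>
    interior_mono hset (by rwa [isOpen_Iio.interior_eq])
  have hopen : IsOpen {z : ℂ | z.re < 0} := isOpen_lt Complex.continuous_re continuous_const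
  have hA : AnalyticOnNhd ℂ (ProbabilityTheory.complexMGF id μ) {z : ℂ | z.re < 0} :=
    ProbabilityTheory.analyticOnNhd_complexMGF.mono hint
  have hB : AnalyticOnNhd ℂ (fun z : ℂ => (-z) ^ (-(a : ℂ)) * Real.Gamma a) {z : ℂ | z.re < 0} := by
    refine DifferentiableOn.analyticOnNhd (fun z hz => ?_) hopen
    refine (((differentiableAt_id.neg).cpow_const (Or.inl ?_)).mul_const _).differentiableWithinAt
    simpa using hz
  have hreal : ∀ b : ℝ, 0 < b → ProbabilityTheory.complexMGF id μ (-b : ℂ) =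
      (b : ℂ) ^ (-(a : ℂ)) * Real.Gamma a := by
    intro b hb
    rw [hmgf]
    have h := Real.integral_rpow_mul_exp_neg_mul_Ioi ha hb
    have h2 : ((∫ t in Ioi (0 : ℝ), t ^ (a - 1) * Real.exp (-(b * t)) : ℝ) : ℂ) =
        (((1 / b) ^ a * Real.Gamma a : ℝ) : ℂ) := by rw [h]
    rw [← integral_complex_ofReal] at h2
    have h3 : (b : ℂ) ^ (-(a : ℂ)) = (((1 / b) ^ a : ℝ) : ℂ) := by
      rw [one_div, Real.inv_rpow hb.le, ← Real.rpow_neg hb.le, Complex.ofReal_cpow hb.le]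
      simp
    rw [h3]
    push_cast at h2 ⊢
    rw [← h2]
    refine integral_congr_ae (Eventually.of_forall fun t => ?_)
    simp
  have hfreq : ∃ᶠ z : ℂ in 𝓝[≠] (-1 : ℂ), ProbabilityTheory.complexMGF id μ z =
      (-z) ^ (-(a : ℂ)) * Real.Gamma a := by
    have ht : Tendsto (fun b : ℝ => (-b : ℂ)) (𝓝[>] 1) (𝓝[≠] (-1 : ℂ)) := by
      refine tendsto_nhdsWithin_iff.2 ⟨?_, ?_⟩
      · have : Continuous fun b : ℝ => (-b : ℂ) := by fun_prop
        simpa using (this.tendsto 1).mono_left nhdsWithin_le_nhds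
      · filter_upwards [self_mem_nhdsWithin] with b hb
        have : b ≠ 1 := ne_of_gt hb
        simpa using this
    refine ht.frequently (Eventually.frequently ?_)
    filter_upwards [self_mem_nhdsWithin] with b hb
    rw [hreal b (lt_trans one_pos hb), neg_neg]
  have hEq := hA.eqOn_of_preconnected_of_frequently_eq hB
    (convex_halfSpace_re_lt 0).isPreconnected (z₀ := -1) (by simp) hfreq
  have := hEq (show -r ∈ {z : ℂ | z.re < 0} by simpa using hr)
  rw [hmgf] at this
  simpa using this

/-! ### The expansion at the origin in a sector -/

theorem continuousAt_norm_rpow {p : ℝ} {z : ℂ} (hz : z ∈ rightQuadrant) :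
    ContinuousAt (fun z : ℂ => ‖z‖ ^ p) z :=
  continuous_norm.continuousAt.rpow_const
    (Or.inl (norm_ne_zero_iff.2 (Complex.slitPlane_ne_zero (rightQuadrant_subset_slitPlane hz))))

theorem norm_boundaryExtension_le_of_growth {F : ℂ → ℂ} {f : ℝ → ℂ} {M δ d R : ℝ}
    (hF : IsContinuationToFirstQuadrant F f)
    (hR : ∀ z ∈ firstQuadrant, R ≤ ‖z‖ → ‖F z‖ ≤ M * ‖z‖ ^ δ * Real.exp (d * z.im))
    (z : ℂ) (hz : z ∈ rightQuadrant) (hzR : R < ‖z‖) :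
    ‖boundaryExtension F f z‖ ≤ M * ‖z‖ ^ δ * Real.exp (d * z.im) :=
  norm_boundaryExtension_le hF (U := {z | R < ‖z‖}) (isOpen_lt continuous_const continuous_norm)
    (ψ := fun z => M * ‖z‖ ^ δ * Real.exp (d * z.im))
    (fun _ hw => (continuousAt_const.mul (continuousAt_norm_rpow hw)).mul (by fun_prop))
    (fun w hw hwU => hR w hw (le_of_lt hwU)) hz hzR

/-- The growth conditions at `0` and at `∞` give a single bound in each sector
`0 ≤ arg z ≤ θ < π / 2`, which is written in the variable `ζ = log z`. -/
theorem exists_growth_bound {F : ℂ → ℂ} {f : ℝ → ℂ} {M δ d θ : ℝ} (hf : ContinuousOn f (Ioi 0))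
    (hF : IsContinuationToFirstQuadrant F f) (hF_zero : HasAlgebraicGrowthAtOrigin F)
    (hM : 0 < M) (hd : 0 ≤ d)
    (hF_growth : ∃ R : ℝ, ∀ z ∈ firstQuadrant, R ≤ ‖z‖ →
      ‖F z‖ ≤ M * ‖z‖ ^ δ * Real.exp (d * z.im)) (hθ : θ < Real.pi / 2) :
    ∃ C K D : ℝ, 0 ≤ C ∧ 0 ≤ K ∧ 0 ≤ D ∧ ∀ ζ : ℂ, 0 ≤ ζ.im → ζ.im ≤ θ →
      ‖boundaryExtension F f (Complex.exp ζ)‖ ≤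
        C * Real.exp (-K * ζ.re + D * Real.exp ζ.re) := by
  obtain ⟨K₀, hK₀⟩ := hF_zero
  obtain ⟨c, hc, hcb⟩ := hK₀.exists_nonneg
  obtain ⟨ε, hε, hεb⟩ := Metric.eventually_nhds_iff.1 (eventually_nhdsWithin_iff.1 hcb.bound)
  obtain ⟨R, hR⟩ := hF_growth
  have hzero : ∀ z ∈ rightQuadrant, ‖z‖ < ε →
      ‖boundaryExtension F f z‖ ≤ c * ‖z‖ ^ (-K₀) := by
    intro z hz hzε
    refine norm_boundaryExtension_le hF (U := {z | ‖z‖ < ε})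
      (isOpen_lt continuous_norm continuous_const) (ψ := fun z => c * ‖z‖ ^ (-K₀))
      (fun w hw => continuousAt_const.mul (continuousAt_norm_rpow hw)) (fun w hw hwU => ?_) hz hzε
    have := hεb (by simpa [dist_zero_right] using hwU) hw
    rwa [Real.norm_of_nonneg (Real.rpow_nonneg (norm_nonneg _) _)] at this
  have hinf := norm_boundaryExtension_le_of_growth hF hR
  have hcomp : IsCompact (Icc (Real.log ε) (Real.log (max R 1)) ×ℂ Icc 0 θ) :=
    isCompact_Icc.reProdIm isCompact_Icc
  obtain ⟨C₂, hC₂⟩ := hcomp.exists_bound_of_continuousOn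
    ((continuousOn_boundaryExtension hf hF).comp Complex.continuous_exp.continuousOn
      fun w hw => exp_mem_rightQuadrant hw.2.1 (hw.2.2.trans_lt hθ))
  refine ⟨c + M + |C₂|, |K₀| + |δ|, d + 2 * |K₀| + 2 * |δ|, by positivity, by positivity,
    by positivity, fun ζ h0 h1 => ?_⟩
  have hmem := exp_mem_rightQuadrant h0 (h1.trans_lt hθ)
  have hn : ‖Complex.exp ζ‖ = Real.exp ζ.re := Complex.norm_exp ζ
  set E := Real.exp (-(|K₀| + |δ|) * ζ.re + (d + 2 * |K₀| + 2 * |δ|) * Real.exp ζ.re) with hE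
  have hE0 : 0 ≤ E := (Real.exp_pos _).le
  rcases lt_or_ge (Real.exp ζ.re) ε with hlt | hge
  · have h := hzero _ hmem (by rwa [hn])
    rw [hn, ← Real.exp_mul] at h
    refine h.trans ?_
    have : Real.exp (ζ.re * -K₀) ≤ E := by
      have := exp_add_mul_exp_mono (p := -K₀) (q := -(|K₀| + |δ|)) (D := 0)
        (D' := d + 2 * |K₀| + 2 * |δ|) (by linarith [le_abs_self K₀, abs_nonneg δ])
        (by linarith [neg_le_abs K₀, abs_nonneg δ]) ζ.re
      rwa [zero_mul, add_zero, mul_comm (-K₀)] at this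
    refine (mul_le_mul_of_nonneg_left this hc).trans ?_
    exact mul_le_mul_of_nonneg_right (by linarith [abs_nonneg C₂]) hE0
  rcases lt_or_ge R (Real.exp ζ.re) with hlt' | hge'
  · have h := hinf _ hmem (by rwa [hn])
    rw [hn, ← Real.exp_mul, mul_assoc, ← Real.exp_add] at h
    refine h.trans ?_
    have him : (Complex.exp ζ).im ≤ Real.exp ζ.re := by
      rw [← hn]; exact (le_abs_self _).trans (Complex.abs_im_le_norm _)
    have : Real.exp (ζ.re * δ + d * (Complex.exp ζ).im) ≤ E := by
      refine le_trans (Real.exp_le_exp.2 ?_) (exp_add_mul_exp_mono (p := δ)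
        (q := -(|K₀| + |δ|)) (D := d) (by linarith [neg_le_abs δ, abs_nonneg K₀])
        (by linarith [le_abs_self δ, abs_nonneg K₀]) ζ.re)
      linarith [mul_le_mul_of_nonneg_left him hd]
    refine (mul_le_mul_of_nonneg_left this hM.le).trans ?_
    exact mul_le_mul_of_nonneg_right (by linarith [abs_nonneg C₂]) hE0
  · have h := hC₂ ζ ⟨⟨(Real.log_le_iff_le_exp hε).2 hge, ?_⟩, h0, h1⟩
    · refine h.trans ?_
      have hE1 : 1 ≤ E := by
        have := exp_add_mul_exp_mono (p := 0) (q := -(|K₀| + |δ|)) (D := 0)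
          (D' := d + 2 * |K₀| + 2 * |δ|) (by linarith [abs_nonneg K₀, abs_nonneg δ])
          (by linarith [abs_nonneg K₀, abs_nonneg δ]) ζ.re
        rwa [zero_mul, zero_mul, add_zero, Real.exp_zero] at this
      calc C₂ ≤ (c + M + |C₂|) * 1 := by linarith [le_abs_self C₂]
        _ ≤ _ := mul_le_mul_of_nonneg_left hE1 (by positivity)
    · exact (Real.le_log_iff_exp_le (by positivity)).2 (hge'.trans (le_max_left _ _))

theorem norm_cexp_sub_mul (j : ℕ) (α : ℝ) (ζ : ℂ) :
    ‖Complex.exp (((j : ℂ) - α) * ζ)‖ = Real.exp (((j : ℝ) - α) * ζ.re) := by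
  rw [Complex.norm_exp]
  simp

theorem norm_sum_cexp_le (a : ℕ → ℂ) (α : ℝ) {s : Finset ℕ} {q D : ℝ}
    (hq : ∀ j ∈ s, q ≤ (j : ℝ) - α) (hD : ∀ j ∈ s, (j : ℝ) - α - q ≤ D) (ζ : ℂ) :
    ‖∑ j ∈ s, a j * Complex.exp (((j : ℂ) - α) * ζ)‖ ≤
      (∑ j ∈ s, ‖a j‖) * Real.exp (q * ζ.re + D * Real.exp ζ.re) := by
  rw [Finset.sum_mul]
  refine norm_sum_le_of_le _ fun j hj => ?_
  rw [norm_mul, norm_cexp_sub_mul]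
  refine mul_le_mul_of_nonneg_left ?_ (norm_nonneg _)
  have := exp_add_mul_exp_mono (D := 0) (D' := D) (hq j hj) (by linarith [hD j hj]) ζ.re
  rwa [zero_mul, add_zero] at this

theorem cexp_cpow {ζ : ℂ} (h0 : 0 ≤ ζ.im) (h1 : ζ.im < Real.pi / 2) (w : ℂ) :
    Complex.exp ζ ^ w = Complex.exp (w * ζ) := by
  rw [Complex.cpow_def_of_ne_zero (Complex.exp_ne_zero _),
    Complex.log_exp (by linarith [Real.pi_pos]) (by linarith [Real.pi_pos]), mul_comm]

/-- The expansion of `f` at the origin extends to the sector `0 ≤ arg z ≤ π / 6`. The remainder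
after sufficiently many terms is so small on the real axis that, by interpolation with the algebraic
growth on `arg z = π / 3`, it is still `O (|z| ^ (N + 1 - α))` in the smaller sector. -/
theorem exists_remainder_bound {F : ℂ → ℂ} {f : ℝ → ℂ} {α : ℝ} {a : ℕ → ℂ}
    (hf : ContinuousOn f (Ioi 0)) (hF : IsContinuationToFirstQuadrant F f)
    (hgrowth : ∃ C K D : ℝ, 0 ≤ C ∧ 0 ≤ K ∧ 0 ≤ D ∧ ∀ ζ : ℂ, 0 ≤ ζ.im → ζ.im ≤ Real.pi / 3 →
      ‖boundaryExtension F f (Complex.exp ζ)‖ ≤ C * Real.exp (-K * ζ.re + D * Real.exp ζ.re))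
    (hα0 : 0 ≤ α) (hα1 : α < 1)
    (hf_asymp : HasAsymptoticExpansion f a (fun j t => t ^ ((j : ℝ) - α)) (𝓝[>] 0)) (N : ℕ) :
    ∃ C D : ℝ, 0 ≤ C ∧ 0 ≤ D ∧ ∀ ζ : ℂ, 0 ≤ ζ.im → ζ.im ≤ Real.pi / 6 →
      ‖boundaryExtension F f (Complex.exp ζ) -
          ∑ j ∈ Finset.range (N + 1), a j * Complex.exp (((j : ℂ) - α) * ζ)‖ ≤
        C * Real.exp (((N : ℝ) + 1 - α) * ζ.re + D * Real.exp ζ.re) := by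
  have hpi := Real.pi_pos
  obtain ⟨C, K, D, hC, hK, hD, hFb⟩ := hgrowth
  -- `n` is chosen such that the mean of the exponents `n - α` and `-(K + 1)`, which the estimate
  -- gives halfway up to `arg z = π / 3`, exceeds `N + 1 - α`
  obtain ⟨n, hn⟩ := exists_nat_ge (K + 2 * N + 4)
  set B : ℝ := n - α with hB
  have hB0 : 0 ≤ B := by rw [hB]; have : (0 : ℝ) ≤ N := N.cast_nonneg; linarith
  have hNn : N + 1 ≤ n + 1 := by
    have h : ((N + 1 : ℕ) : ℝ) ≤ ((n + 1 : ℕ) : ℝ) := by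
      push_cast; have : (0 : ℝ) ≤ N := N.cast_nonneg; linarith
    exact_mod_cast h
  set G : ℂ → ℂ := fun z => boundaryExtension F f z -
    ∑ j ∈ Finset.range (n + 1), a j * z ^ ((j : ℂ) - α) with hG
  have hGexp : ∀ ζ : ℂ, 0 ≤ ζ.im → ζ.im < Real.pi / 2 → G (Complex.exp ζ) =
      boundaryExtension F f (Complex.exp ζ) -
        ∑ j ∈ Finset.range (n + 1), a j * Complex.exp (((j : ℂ) - α) * ζ) := by
    intro ζ h0 h1
    simp only [hG, cexp_cpow h0 h1]
  have hGd : DifferentiableOn ℂ G firstQuadrant := by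
    refine (differentiableOn_boundaryExtension hF).sub (DifferentiableOn.fun_sum fun j _ => ?_)
    intro z hz
    exact ((differentiableAt_id.cpow_const (rightQuadrant_subset_slitPlane
      (firstQuadrant_subset_rightQuadrant hz))).const_mul _).differentiableWithinAt
  have hGc : ContinuousOn G rightQuadrant := by
    refine (continuousOn_boundaryExtension hf hF).sub (continuousOn_finsetSum _ fun j _ => ?_)
    intro z hz
    exact ((continuousAt_id.cpow continuousAt_const (rightQuadrant_subset_slitPlane
      hz)).const_mul _).continuousWithinAt
  set A : ℝ := ∑ j ∈ Finset.range (n + 1), ‖a j‖ with hA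
  have hA0 : 0 ≤ A := Finset.sum_nonneg fun _ _ => norm_nonneg _
  set D₁ : ℝ := D + n + K + 1 with hD₁
  have hn0 : (0 : ℝ) ≤ n := n.cast_nonneg
  have hsector : ∀ ζ : ℂ, 0 ≤ ζ.im → ζ.im ≤ Real.pi / 3 →
      ‖G (Complex.exp ζ)‖ ≤ (C + A) * Real.exp (-(K + 1) * ζ.re + D₁ * Real.exp ζ.re) := by
    intro ζ h0 h1
    rw [hGexp ζ h0 (by linarith), add_mul]
    refine (norm_sub_le _ _).trans (add_le_add ?_ ?_)
    · exact (hFb ζ h0 h1).trans (mul_le_mul_of_nonneg_left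
        (exp_add_mul_exp_mono (by linarith) (by linarith) _) hC)
    · refine norm_sum_cexp_le a α (fun j _ => ?_) (fun j hj => ?_) ζ
      · have : (0 : ℝ) ≤ j := j.cast_nonneg
        linarith
      · have : (j : ℝ) ≤ n := by exact_mod_cast Nat.lt_succ_iff.1 (Finset.mem_range.1 hj)
        linarith
  obtain ⟨c, hc, hcb⟩ := (hf_asymp n).isBigO.exists_nonneg
  obtain ⟨ε, hε, hεb⟩ := mem_nhdsGT_iff_exists_Ioo_subset.1 hcb.bound
  have hε : 0 < ε := hε
  set X : ℝ := Real.exp (-(K + 1 + B) * Real.log ε) with hX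
  have hX0 : 0 < X := Real.exp_pos _
  set C₁ : ℝ := (C + A) * (1 + X) + c with hC₁
  -- beyond `ε`, where the expansion says nothing, the sector bound is worse than `r ^ B` only by
  -- the constant factor `X`
  have hreal : ∀ u : ℝ, ‖G (Complex.exp u)‖ ≤ C₁ * Real.exp (B * u + D₁ * Real.exp u) := by
    intro u
    rcases lt_or_ge (Real.exp u) ε with hlt | hge
    · have h := hεb ⟨Real.exp_pos u, hlt⟩
      simp only [mem_ofPred_eq, ← Real.exp_mul] at h
      rw [Real.norm_of_nonneg (Real.exp_pos _).le] at h
      have h2 : G (Complex.exp u) = f (Real.exp u) -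
          ∑ j ∈ Finset.range (n + 1), a j * ((Real.exp (u * ((j : ℝ) - α)) : ℝ) : ℂ) := by
        rw [hGexp _ (by simp) (by simpa using by positivity), ← Complex.ofReal_exp,
          boundaryExtension_ofReal]
        congr 1
        refine Finset.sum_congr rfl fun j _ => ?_
        push_cast
        rw [mul_comm (u : ℂ)]
      rw [h2]
      refine h.trans ?_
      refine mul_le_mul ?_ ?_ (Real.exp_pos _).le (by positivity)
      · have : 0 ≤ (C + A) * (1 + X) := by positivity
        linarith
      · refine Real.exp_le_exp.2 ?_
        have : 0 ≤ D₁ * Real.exp u := by positivity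
        rw [mul_comm u]
        linarith
    · have h := hsector u (by simp) (by simpa using by positivity)
      simp only [Complex.ofReal_re] at h
      refine h.trans ?_
      have hlog : Real.log ε ≤ u := (Real.log_le_iff_le_exp hε).2 hge
      have h2 : Real.exp (-(K + 1) * u + D₁ * Real.exp u) ≤
          X * Real.exp (B * u + D₁ * Real.exp u) := by
        rw [hX, ← Real.exp_add]
        refine Real.exp_le_exp.2 ?_
        nlinarith [mul_le_mul_of_nonneg_left hlog (by linarith : 0 ≤ K + 1 + B)]
      refine (mul_le_mul_of_nonneg_left h2 (by positivity)).trans ?_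
      rw [← mul_assoc]
      refine mul_le_mul_of_nonneg_right ?_ (Real.exp_pos _).le
      rw [hC₁]
      nlinarith [mul_nonneg (add_nonneg hC hA0) hX0.le]
  have hCC : C + A ≤ C₁ := by
    rw [hC₁]; nlinarith [mul_nonneg (add_nonneg hC hA0) hX0.le]
  have hC₁0 : 0 ≤ C₁ := by positivity
  set D₂ : ℝ := D₁ / Real.cos (Real.pi / 3) + B with hD₂
  have hcos : 0 < Real.cos (Real.pi / 3) := by rw [Real.cos_pi_div_three]; norm_num
  have hD₂0 : 0 ≤ D₁ / Real.cos (Real.pi / 3) := by positivity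
  refine ⟨C₁ + A, D₂ + n, by positivity, by positivity, fun ζ h0 h1 => ?_⟩
  have h := norm_le_of_sector (θ := Real.pi / 3) (by positivity) (by linarith) hGd hGc
    (by linarith : 0 ≤ K + 1) hB0 (by positivity : 0 ≤ D₁)
    (fun ζ h0 h1 => (hsector ζ h0 h1).trans
      (mul_le_mul_of_nonneg_right hCC (Real.exp_pos _).le)) hreal h0 (by linarith)
  have hv0 : 0 ≤ ζ.im / (Real.pi / 3) := by positivity
  have hv : ζ.im / (Real.pi / 3) ≤ 1 / 2 := by
    rw [div_le_iff₀ (by positivity)]; linarith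
  have hN0 : (0 : ℝ) ≤ N := N.cast_nonneg
  have hsplit : boundaryExtension F f (Complex.exp ζ) -
        ∑ j ∈ Finset.range (N + 1), a j * Complex.exp (((j : ℂ) - α) * ζ) =
      G (Complex.exp ζ) +
        ∑ j ∈ Finset.Ico (N + 1) (n + 1), a j * Complex.exp (((j : ℂ) - α) * ζ) := by
    rw [hGexp ζ h0 (by linarith), Finset.sum_Ico_eq_sub _ hNn]
    ring
  rw [hsplit, add_mul]
  refine (norm_add_le _ _).trans (add_le_add ?_ ?_)
  · refine h.trans (mul_le_mul_of_nonneg_left (exp_add_mul_exp_mono ?_ ?_ _) hC₁0)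
    · nlinarith [mul_le_mul_of_nonneg_left hv (by linarith : 0 ≤ K + 1 + B)]
    · nlinarith [mul_nonneg (by linarith : 0 ≤ K + 1 + B) hv0]
  · refine (norm_sum_cexp_le a α (q := (N : ℝ) + 1 - α) (D := D₂ + n) (fun j hj => ?_)
      (fun j hj => ?_) ζ).trans (mul_le_mul_of_nonneg_right ?_ (Real.exp_pos _).le)
    · have : ((N + 1 : ℕ) : ℝ) ≤ j := by exact_mod_cast (Finset.mem_Ico.1 hj).1
      push_cast at this
      linarith
    · have : (j : ℝ) ≤ n := by exact_mod_cast Nat.lt_succ_iff.1 (Finset.mem_Ico.1 hj).2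
      linarith
    · exact Finset.sum_le_sum_of_subset_of_nonneg
        (fun j hj => Finset.mem_range.2 (Finset.mem_Ico.1 hj).2) fun _ _ _ => norm_nonneg _

/-! ### Contour deformation for the Hilbert transform -/

theorem ofReal_mul_cexp_re (r φ : ℝ) : (r * Complex.exp (φ * Complex.I)).re = r * Real.cos φ := by
  rw [Complex.re_ofReal_mul, Complex.exp_ofReal_mul_I_re]

theorem ofReal_mul_cexp_im (r φ : ℝ) : (r * Complex.exp (φ * Complex.I)).im = r * Real.sin φ := by
  rw [Complex.im_ofReal_mul, Complex.exp_ofReal_mul_I_im]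

theorem norm_ofReal_mul_cexp {r : ℝ} (hr : 0 ≤ r) (φ : ℝ) :
    ‖r * Complex.exp (φ * Complex.I)‖ = r := by
  rw [norm_mul, Complex.norm_exp_ofReal_mul_I, mul_one, Complex.norm_of_nonneg hr]

theorem ofReal_mul_cexp_mem {r φ : ℝ} (hr : 0 < r) (h0 : 0 ≤ φ) (h1 : φ < Real.pi / 2) :
    r * Complex.exp (φ * Complex.I) ∈ rightQuadrant := by
  refine ⟨?_, ?_⟩
  · rw [ofReal_mul_cexp_re]
    exact mul_pos hr (Real.cos_pos_of_mem_Ioo ⟨by linarith [Real.pi_pos], h1⟩)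
  · rw [ofReal_mul_cexp_im]
    exact mul_nonneg hr.le (Real.sin_nonneg_of_nonneg_of_le_pi h0 (by linarith [Real.pi_pos]))

theorem ofReal_mul_cexp_eq {r : ℝ} (hr : 0 < r) (φ : ℝ) :
    r * Complex.exp (φ * Complex.I) = Complex.exp (Real.log r + φ * Complex.I) := by
  rw [Complex.exp_add, ← Complex.ofReal_exp, Real.exp_log hr]

/-- The integrand `F(z) e ^ (iωz) / (z - x)` of the Hilbert transform in the complex domain. -/
noncomputable def hilbertKernel (F : ℂ → ℂ) (f : ℝ → ℂ) (ω x : ℝ) (z : ℂ) : ℂ :=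
  boundaryExtension F f z * Complex.exp (Complex.I * ω * z) / (z - x)

section Kernel

variable {F : ℂ → ℂ} {f : ℝ → ℂ} {ω x : ℝ}

theorem hilbertKernel_ofReal (t : ℝ) :
    hilbertKernel F f ω x t = oscillatory f ω t / ((t : ℂ) - (x : ℂ)) := by
  rw [hilbertKernel, boundaryExtension_ofReal, oscillatory]

theorem norm_cexp_I_mul (ω : ℝ) (z : ℂ) :
    ‖Complex.exp (Complex.I * ω * z)‖ = Real.exp (-(ω * z.im)) := by
  rw [Complex.norm_exp]
  simp

theorem continuousOn_hilbertKernel (hf : ContinuousOn f (Ioi 0))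
    (hF : IsContinuationToFirstQuadrant F f) :
    ContinuousOn (hilbertKernel F f ω x) {z ∈ rightQuadrant | z ≠ x} := by
  refine ContinuousOn.div (ContinuousOn.mul
    ((continuousOn_boundaryExtension hf hF).mono fun z hz => hz.1) (by fun_prop)) (by fun_prop) ?_
  exact fun z hz => sub_ne_zero.2 hz.2

theorem differentiableOn_hilbertKernel (hF : IsContinuationToFirstQuadrant F f) :
    DifferentiableOn ℂ (hilbertKernel F f ω x) firstQuadrant := by
  refine DifferentiableOn.div (DifferentiableOn.mul (differentiableOn_boundaryExtension hF)
    (by fun_prop)) (by fun_prop) ?_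
  intro z hz h
  have := hz.2
  rw [sub_eq_zero.1 h] at this
  simp at this

theorem ray_mem {s : ℝ} (hs : 0 < s) :
    (s * Complex.exp ((Real.pi / 6 : ℝ) * Complex.I) : ℂ) ∈ {z ∈ rightQuadrant | z ≠ (x : ℂ)} := by
  have hpi := Real.pi_pos
  refine ⟨ofReal_mul_cexp_mem hs (by positivity) (by linarith), fun h => ?_⟩
  have := congrArg Complex.im h
  rw [ofReal_mul_cexp_im, Real.sin_pi_div_six, Complex.ofReal_im] at this
  linarith

theorem continuousOn_ray (hf : ContinuousOn f (Ioi 0)) (hF : IsContinuationToFirstQuadrant F f) :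
    ContinuousOn (fun s : ℝ =>
      hilbertKernel F f ω x (s * Complex.exp ((Real.pi / 6 : ℝ) * Complex.I)) *
        Complex.exp ((Real.pi / 6 : ℝ) * Complex.I)) (Ioi 0) := by
  refine ContinuousOn.mul ?_ continuousOn_const
  exact (continuousOn_hilbertKernel hf hF).comp (by fun_prop) fun s hs => ray_mem hs

/-- The growth condition on an arc of large radius; `r` accounts for the length of the arc. -/
theorem norm_hilbertKernel_le_of_large {M δ d R₀ : ℝ} (hM : 0 < M)
    (hbound : ∀ z ∈ rightQuadrant, R₀ < ‖z‖ →
      ‖boundaryExtension F f z‖ ≤ M * ‖z‖ ^ δ * Real.exp (d * z.im))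
    (hx : 0 < x) {r φ : ℝ} (hr : R₀ < r) (hrx : 2 * x ≤ r) (h0 : 0 ≤ φ)
    (h1 : φ < Real.pi / 2) :
    ‖hilbertKernel F f ω x (r * Complex.exp (φ * Complex.I))‖ * r ≤
      2 * M * r ^ δ * Real.exp (-((ω - d) * r * Real.sin φ)) := by
  have hr0 : 0 < r := by linarith
  have hn := norm_ofReal_mul_cexp hr0.le φ
  have hb := hbound _ (ofReal_mul_cexp_mem hr0 h0 h1) (by rwa [hn])
  have hden : r / 2 ≤ ‖r * Complex.exp (φ * Complex.I) - x‖ := by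
    have := norm_sub_norm_le (r * Complex.exp (φ * Complex.I)) (x : ℂ)
    rw [hn, Complex.norm_of_nonneg hx.le] at this
    linarith
  rw [hn, ofReal_mul_cexp_im] at hb
  rw [hilbertKernel, norm_div, norm_mul, norm_cexp_I_mul, ofReal_mul_cexp_im, div_mul_eq_mul_div,
    div_le_iff₀ (by linarith)]
  have hE : Real.exp (-((ω - d) * r * Real.sin φ)) =
      Real.exp (d * (r * Real.sin φ)) * Real.exp (-(ω * (r * Real.sin φ))) := by
    rw [← Real.exp_add]; ring_nf
  rw [hE]
  calc ‖boundaryExtension F f (r * Complex.exp (φ * Complex.I))‖ *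
        Real.exp (-(ω * (r * Real.sin φ))) * r
      ≤ M * r ^ δ * Real.exp (d * (r * Real.sin φ)) * Real.exp (-(ω * (r * Real.sin φ))) * r := by
        gcongr
    _ = 2 * M * r ^ δ * (Real.exp (d * (r * Real.sin φ)) *
          Real.exp (-(ω * (r * Real.sin φ)))) * (r / 2) := by ring
    _ ≤ _ := by
        refine mul_le_mul_of_nonneg_left hden ?_
        positivity

theorem norm_hilbertKernel_le_of_small {C D α : ℝ} (hω : 0 ≤ ω) (hC : 0 ≤ C)
    (hsmall : ∀ ζ : ℂ, 0 ≤ ζ.im → ζ.im ≤ Real.pi / 6 →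
      ‖boundaryExtension F f (Complex.exp ζ)‖ ≤ C * Real.exp (-α * ζ.re + D * Real.exp ζ.re))
    (hD : 0 ≤ D) (hx : 0 < x) {r φ : ℝ} (hr : 0 < r) (hrx : r ≤ x / 2) (h0 : 0 ≤ φ)
    (h1 : φ ≤ Real.pi / 6) :
    ‖hilbertKernel F f ω x (r * Complex.exp (φ * Complex.I))‖ ≤
      C * Real.exp (D * x) / (x / 2) * r ^ (-α) := by
  have hpi := Real.pi_pos
  have hn := norm_ofReal_mul_cexp hr.le φ
  have hb := hsmall (Real.log r + φ * Complex.I)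
    (by simpa [Complex.log_im, Complex.arg_ofReal_of_nonneg hr.le] using h0)
    (by simpa [Complex.log_im, Complex.arg_ofReal_of_nonneg hr.le] using h1)
  have hre : ((Real.log r : ℂ) + φ * Complex.I).re = Real.log r := by simp
  rw [hre, ← ofReal_mul_cexp_eq hr, Real.exp_log hr, Real.exp_add, mul_comm (-α),
    ← Real.rpow_def_of_pos hr] at hb
  have hden : x / 2 ≤ ‖r * Complex.exp (φ * Complex.I) - x‖ := by
    have := norm_sub_norm_le (x : ℂ) (r * Complex.exp (φ * Complex.I))
    rw [hn, Complex.norm_of_nonneg hx.le, norm_sub_rev] at this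
    linarith
  have hexp : ‖Complex.exp (Complex.I * ω * (r * Complex.exp (φ * Complex.I)))‖ ≤ 1 := by
    rw [norm_cexp_I_mul]
    refine Real.exp_le_one_iff.2 (neg_nonpos.2 (mul_nonneg hω ?_))
    exact (ofReal_mul_cexp_mem hr h0 (by linarith)).2
  have hexp2 : Real.exp (D * r) ≤ Real.exp (D * x) :=
    Real.exp_le_exp.2 (mul_le_mul_of_nonneg_left (by linarith) hD)
  rw [hilbertKernel, norm_div, norm_mul]
  calc _ ≤ (C * (r ^ (-α) * Real.exp (D * r))) * 1 / (x / 2) := by gcongr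
    _ ≤ (C * (r ^ (-α) * Real.exp (D * x))) * 1 / (x / 2) := by gcongr
    _ = _ := by ring

/-- Jordan's lemma for the arcs between the real axis and the ray `arg z = π / 6`. -/
theorem tendsto_large_arc {M δ d R₀ : ℝ} (hM : 0 < M) (hδ : δ < 1) (hω : d < ω)
    (hbound : ∀ z ∈ rightQuadrant, R₀ < ‖z‖ →
      ‖boundaryExtension F f z‖ ≤ M * ‖z‖ ^ δ * Real.exp (d * z.im)) (hx : 0 < x) :
    Tendsto (fun r : ℝ => ∫ φ in (0 : ℝ)..(Real.pi / 6),
      hilbertKernel F f ω x (r * Complex.exp (φ * Complex.I)) *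
        (r * Complex.exp (φ * Complex.I) * Complex.I)) atTop (𝓝 0) := by
  have hpi := Real.pi_pos
  set b : ℝ := (ω - d) * (2 / Real.pi) with hb
  have hb0 : 0 < b := mul_pos (by linarith) (by positivity)
  have hlim : Tendsto (fun r : ℝ => 2 * M / b * r ^ (-(1 - δ))) atTop (𝓝 0) := by
    simpa using (tendsto_rpow_neg_atTop (by linarith : 0 < 1 - δ)).const_mul (2 * M / b)
  refine squeeze_zero_norm' ?_ hlim
  filter_upwards [eventually_gt_atTop R₀, eventually_ge_atTop (2 * x), eventually_gt_atTop 0]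
    with r hr hrx hr0
  have hc : 0 < b * r := mul_pos hb0 hr0
  have h := intervalIntegral.norm_integral_le_of_norm_le
    (f := fun φ : ℝ => hilbertKernel F f ω x (r * Complex.exp (φ * Complex.I)) *
        (r * Complex.exp (φ * Complex.I) * Complex.I))
    (g := fun φ : ℝ => 2 * M * r ^ δ * Real.exp (-(b * r) * φ)) (μ := volume)
    (a := 0) (b := Real.pi / 6) (by positivity) (Eventually.of_forall fun φ hφ => ?_)
    (Continuous.intervalIntegrable (by fun_prop) _ _)
  · refine h.trans ?_
    rw [intervalIntegral.integral_const_mul, intervalIntegral.integral_comp_mul_left _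
      (neg_ne_zero.2 hc.ne'), integral_exp, mul_zero, Real.exp_zero, smul_eq_mul]
    have h1 : (-(b * r))⁻¹ * (Real.exp (-(b * r) * (Real.pi / 6)) - 1) ≤ (b * r)⁻¹ := by
      rw [inv_neg]
      nlinarith [mul_pos (inv_pos.2 hc) (Real.exp_pos (-(b * r) * (Real.pi / 6)))]
    calc _ ≤ 2 * M * r ^ δ * (b * r)⁻¹ := mul_le_mul_of_nonneg_left h1 (by positivity)
      _ = 2 * M / b * (r ^ δ * r⁻¹) := by field_simp
      _ = _ := by rw [← Real.rpow_neg_one r, ← Real.rpow_add hr0]; ring_nf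
  · have h1 := norm_hilbertKernel_le_of_large (ω := ω) (φ := φ) hM hbound hx hr hrx hφ.1.le
      (by linarith [hφ.2])
    rw [norm_mul, norm_mul, Complex.norm_I, mul_one, norm_ofReal_mul_cexp hr0.le]
    refine h1.trans (mul_le_mul_of_nonneg_left (Real.exp_le_exp.2 ?_) (by positivity))
    have h2 := mul_le_mul_of_nonneg_left (Real.mul_le_sin hφ.1.le (by linarith [hφ.2]))
      (mul_nonneg (by linarith : 0 ≤ ω - d) hr0.le)
    rw [hb]
    linarith

theorem tendsto_small_arc {C D α : ℝ} (hω : 0 ≤ ω) (hC : 0 ≤ C) (hD : 0 ≤ D) (hα : α < 1)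
    (hsmall : ∀ ζ : ℂ, 0 ≤ ζ.im → ζ.im ≤ Real.pi / 6 →
      ‖boundaryExtension F f (Complex.exp ζ)‖ ≤ C * Real.exp (-α * ζ.re + D * Real.exp ζ.re))
    (hx : 0 < x) :
    Tendsto (fun r : ℝ => ∫ φ in (0 : ℝ)..(Real.pi / 6),
      hilbertKernel F f ω x (r * Complex.exp (φ * Complex.I)) *
        (r * Complex.exp (φ * Complex.I) * Complex.I)) (𝓝[>] 0) (𝓝 0) := by
  have hpi := Real.pi_pos
  have hlim : Tendsto (fun r : ℝ => C * Real.exp (D * x) / (x / 2) * r ^ (1 - α) *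
      |Real.pi / 6 - 0|) (𝓝[>] 0) (𝓝 0) := by
    have h1 : Tendsto (fun r : ℝ => r ^ (1 - α)) (𝓝[>] 0) (𝓝 0) := by
      have := (Real.continuousAt_rpow_const 0 (1 - α) (Or.inr (by linarith))).tendsto
      rw [Real.zero_rpow (by linarith)] at this
      exact this.mono_left nhdsWithin_le_nhds
    simpa using (h1.const_mul (C * Real.exp (D * x) / (x / 2))).mul_const |Real.pi / 6 - 0|
  refine squeeze_zero_norm' ?_ hlim
  filter_upwards [Ioo_mem_nhdsGT (show (0 : ℝ) < x / 2 by positivity)] with r hr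
  refine intervalIntegral.norm_integral_le_of_norm_le_const fun φ hφ => ?_
  rw [uIoc_of_le (by positivity)] at hφ
  have h1 := norm_hilbertKernel_le_of_small hω hC hsmall hD hx hr.1 hr.2.le hφ.1.le hφ.2
  rw [norm_mul, norm_mul, Complex.norm_I, mul_one, norm_ofReal_mul_cexp hr.1.le]
  refine (mul_le_mul_of_nonneg_right h1 hr.1.le).trans (le_of_eq ?_)
  rw [mul_assoc, ← Real.rpow_add_one hr.1.ne']
  ring_nf

theorem integrableOn_ray {M δ d R₀ C D α : ℝ} (hf : ContinuousOn f (Ioi 0))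
    (hF : IsContinuationToFirstQuadrant F f) (hM : 0 < M) (hδ : δ < 1) (hd : 0 ≤ d) (hω : d < ω)
    (hbound : ∀ z ∈ rightQuadrant, R₀ < ‖z‖ →
      ‖boundaryExtension F f z‖ ≤ M * ‖z‖ ^ δ * Real.exp (d * z.im))
    (hC : 0 ≤ C) (hD : 0 ≤ D) (hα : α < 1)
    (hsmall : ∀ ζ : ℂ, 0 ≤ ζ.im → ζ.im ≤ Real.pi / 6 →
      ‖boundaryExtension F f (Complex.exp ζ)‖ ≤ C * Real.exp (-α * ζ.re + D * Real.exp ζ.re))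
    (hx : 0 < x) :
    IntegrableOn (fun s : ℝ =>
      hilbertKernel F f ω x (s * Complex.exp ((Real.pi / 6 : ℝ) * Complex.I)) *
        Complex.exp ((Real.pi / 6 : ℝ) * Complex.I)) (Ioi 0) := by
  have hpi := Real.pi_pos
  have hcont := continuousOn_ray (ω := ω) (x := x) hf hF
  set h : ℝ → ℂ := fun s : ℝ =>
    hilbertKernel F f ω x (s * Complex.exp ((Real.pi / 6 : ℝ) * Complex.I)) *
      Complex.exp ((Real.pi / 6 : ℝ) * Complex.I) with hh
  have hnorm : ∀ s, ‖h s‖ =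
      ‖hilbertKernel F f ω x (s * Complex.exp ((Real.pi / 6 : ℝ) * Complex.I))‖ := by
    intro s
    rw [hh]
    simp only [norm_mul, Complex.norm_exp_ofReal_mul_I, mul_one]
  set T : ℝ := max (max (R₀ + 1) (2 * x)) 1 with hT
  have hT1 : 1 ≤ T := le_max_right _ _
  have hTx : 2 * x ≤ T := (le_max_right _ _).trans (le_max_left _ _)
  have hTR : R₀ < T := by
    have : R₀ + 1 ≤ T := (le_max_left _ _).trans (le_max_left _ _)
    linarith
  -- the integrand is `O (s ^ (-α))` near `0` and decays exponentially beyond `T`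
  have hunion : Ioi (0 : ℝ) = Ioc 0 (x / 2) ∪ (Icc (x / 2) T ∪ Ioi T) := by
    ext s
    simp only [mem_Ioi, mem_union, mem_Ioc, mem_Icc]
    constructor
    · intro hs
      rcases le_or_gt s (x / 2) with h1 | h1
      · exact Or.inl ⟨hs, h1⟩
      rcases le_or_gt s T with h2 | h2
      · exact Or.inr (Or.inl ⟨h1.le, h2⟩)
      · exact Or.inr (Or.inr h2)
    · rintro (h1 | h1 | h1)
      · exact h1.1
      · linarith [h1.1]
      · exact lt_trans (by linarith) (mem_Ioi.1 h1)
  rw [hunion]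
  refine IntegrableOn.union ?_ (IntegrableOn.union ?_ ?_)
  · have hi : IntegrableOn (fun s : ℝ => C * Real.exp (D * x) / (x / 2) * s ^ (-α))
        (Ioc 0 (x / 2)) := by
      refine Integrable.const_mul ?_ _
      exact (intervalIntegrable_iff_integrableOn_Ioc_of_le (by positivity)).1
        (intervalIntegral.intervalIntegrable_rpow' (by linarith))
    refine hi.mono' ((hcont.mono fun s hs => hs.1).aestronglyMeasurable measurableSet_Ioc) ?_
    refine (ae_restrict_iff' measurableSet_Ioc).2 (Eventually.of_forall fun s hs => ?_)
    rw [hnorm]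
    exact norm_hilbertKernel_le_of_small (by linarith) hC hsmall hD hx hs.1 hs.2 (by positivity)
      le_rfl
  · refine (hcont.mono fun s hs => ?_).integrableOn_compact isCompact_Icc
    exact lt_of_lt_of_le (by positivity) hs.1
  · have hb : 0 < (ω - d) / 2 := by linarith
    have hi : IntegrableOn (fun s : ℝ => 2 * M * Real.exp (-((ω - d) / 2) * s)) (Ioi T) :=
      (exp_neg_integrableOn_Ioi T hb).const_mul _
    refine hi.mono' ((hcont.mono fun s hs => ?_).aestronglyMeasurable measurableSet_Ioi) ?_
    · exact lt_trans (by linarith) (mem_Ioi.1 hs)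
    refine (ae_restrict_iff' measurableSet_Ioi).2 (Eventually.of_forall fun s hs => ?_)
    have hs : T < s := hs
    have hs0 : 0 < s := by linarith
    have h1 := norm_hilbertKernel_le_of_large (ω := ω) (φ := Real.pi / 6) hM hbound hx
      (hTR.trans hs) (hTx.trans hs.le) (by positivity) (by linarith)
    rw [← hnorm, Real.sin_pi_div_six] at h1
    have h2 : s ^ δ ≤ s := by
      simpa using Real.rpow_le_rpow_of_exponent_le (by linarith : 1 ≤ s) hδ.le
    refine le_of_mul_le_mul_right (h1.trans ?_) hs0
    have h3 : -((ω - d) * s * (1 / 2)) = -((ω - d) / 2) * s := by ring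
    rw [h3]
    have := mul_le_mul_of_nonneg_left h2 (mul_nonneg (by linarith : 0 ≤ 2 * M)
      (Real.exp_pos (-((ω - d) / 2) * s)).le)
    linarith

theorem tendsto_integral_left {h : ℝ → ℂ} {b : ℝ} (hb : 0 < b) (hi : IntegrableOn h (Icc 0 b)) :
    Tendsto (fun r => ∫ s in r..b, h s) (𝓝[>] 0) (𝓝 (∫ s in (0 : ℝ)..b, h s)) := by
  have h1 := intervalIntegral.continuousOn_primitive_interval_left
    (show IntegrableOn h (uIcc 0 b) by rwa [uIcc_of_le hb.le])
  rw [uIcc_of_le hb.le] at h1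
  refine (h1 0 (left_mem_Icc.2 hb.le)).tendsto.mono_left ?_
  rw [nhdsWithin_le_iff]
  exact mem_of_superset (Ioo_mem_nhdsGT hb) Ioo_subset_Icc_self

/-- The Hilbert transform is half a residue at `x` plus the integral over the ray
`arg z = π / 6`. -/
theorem hasOneSidedHilbert_ray {M δ d R₀ C D α : ℝ} (hf_int : LocallyIntegrableOn f (Ici 0))
    (hf : ContinuousOn f (Ioi 0))
    (hF : IsContinuationToFirstQuadrant F f) (hM : 0 < M) (hδ : δ < 1) (hd : 0 ≤ d) (hω : d < ω)
    (hbound : ∀ z ∈ rightQuadrant, R₀ < ‖z‖ →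
      ‖boundaryExtension F f z‖ ≤ M * ‖z‖ ^ δ * Real.exp (d * z.im))
    (hC : 0 ≤ C) (hD : 0 ≤ D) (hα : α < 1)
    (hsmall : ∀ ζ : ℂ, 0 ≤ ζ.im → ζ.im ≤ Real.pi / 6 →
      ‖boundaryExtension F f (Complex.exp ζ)‖ ≤ C * Real.exp (-α * ζ.re + D * Real.exp ζ.re))
    (hx : 0 < x) :
    HasOneSidedHilbert (oscillatory f ω) x
      (Complex.I * Real.pi * Complex.exp (Complex.I * ω * x) * f x +
        ∫ s in Ioi (0 : ℝ),
          hilbertKernel F f ω x (s * Complex.exp ((Real.pi / 6 : ℝ) * Complex.I)) *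
            Complex.exp ((Real.pi / 6 : ℝ) * Complex.I)) := by
  have hpi := Real.pi_pos
  have hint := integrableOn_ray hf hF hM hδ hd hω hbound hC hD hα hsmall hx
  set κ : ℂ := Complex.exp ((Real.pi / 6 : ℝ) * Complex.I) with hκ
  set g : ℂ → ℂ := hilbertKernel F f ω x with hg
  set J : ℂ := ∫ s in Ioi (0 : ℝ), g (s * κ) * κ with hJ
  obtain ⟨P, hP⟩ := exists_boundary_primitive (g := g) (D := {z ∈ rightQuadrant | z ≠ (x : ℂ)})
    (differentiableOn_hilbertKernel hF) (continuousOn_hilbertKernel hf hF)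
    (fun z hz => ⟨firstQuadrant_subset_rightQuadrant hz, fun h => by
      have := hz.2; rw [h] at this; simp at this⟩) (fun z hz => hz.1)
  -- the increments of the primitive along the real axis, the ray, the arcs between them, and the
  -- upper half circles around `x`
  have hreal : ∀ a b : ℝ, a ≤ b → (∀ t ∈ Icc a b, 0 < t ∧ t ≠ x) →
      ∫ t in a..b, oscillatory f ω t / ((t : ℂ) - (x : ℂ)) = P b - P a := by
    intro a b hab h
    have := hP (fun t : ℝ => (t : ℂ)) (fun _ => 1) (fun t => Complex.ofRealCLM.hasDerivAt)
      continuous_const a b hab (fun t ht => ⟨⟨by simpa using (h t ht).1, by simp⟩,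
        by exact_mod_cast (h t ht).2⟩)
    rw [← this]
    refine intervalIntegral.integral_congr fun t _ => ?_
    simp only [hg, hilbertKernel_ofReal, mul_one]
  have hray : ∀ a b : ℝ, 0 < a → a ≤ b → ∫ s in a..b, g (s * κ) * κ = P (b * κ) - P (a * κ) := by
    intro a b ha hab
    refine hP (fun s : ℝ => s * κ) (fun _ => κ) (fun s => ?_) continuous_const a b hab
      (fun s hs => ray_mem (ha.trans_le hs.1))
    simpa using (Complex.ofRealCLM.hasDerivAt (x := s)).mul_const κ
  have hcirc : ∀ (c : ℂ) (r φ : ℝ), HasDerivAt (fun φ : ℝ => c + r * Complex.exp (φ * Complex.I))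
      (r * Complex.exp (φ * Complex.I) * Complex.I) φ := by
    intro c r φ
    have h1 : HasDerivAt (fun φ : ℝ => (φ : ℂ) * Complex.I) Complex.I φ := by
      simpa using (Complex.ofRealCLM.hasDerivAt (x := φ)).mul_const Complex.I
    simpa [mul_assoc] using (h1.cexp.const_mul (r : ℂ)).const_add c
  have harc : ∀ r : ℝ, 0 < r → r ≠ x → ∫ φ in (0 : ℝ)..(Real.pi / 6),
      g (r * Complex.exp (φ * Complex.I)) * (r * Complex.exp (φ * Complex.I) * Complex.I) =
        P (r * κ) - P r := by
    intro r hr hrx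
    have := hP (fun φ : ℝ => 0 + r * Complex.exp (φ * Complex.I)) _ (hcirc 0 r) (by fun_prop) 0
      (Real.pi / 6) (by positivity) (fun φ hφ => ?_)
    · simp only [zero_add, Complex.ofReal_zero, zero_mul, Complex.exp_zero, mul_one] at this
      exact this
    · rw [zero_add]
      refine ⟨ofReal_mul_cexp_mem hr hφ.1 (by linarith [hφ.2]), fun h => hrx ?_⟩
      have := congrArg norm h
      rwa [norm_ofReal_mul_cexp hr.le, Complex.norm_of_nonneg hx.le] at this
  have hhalf : ∀ ε : ℝ, 0 < ε → ε < x → ∫ φ in (0 : ℝ)..Real.pi,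
      Complex.I * (boundaryExtension F f (x + ε * Complex.exp (φ * Complex.I)) *
        Complex.exp (Complex.I * ω * (x + ε * Complex.exp (φ * Complex.I)))) =
        P ((x - ε : ℝ) : ℂ) - P ((x + ε : ℝ) : ℂ) := by
    intro ε hε hεx
    have := hP (fun φ : ℝ => x + ε * Complex.exp (φ * Complex.I)) _ (hcirc x ε) (by fun_prop) 0
      Real.pi (by positivity) (fun φ hφ => ?_)
    · simp only [Complex.exp_pi_mul_I, Complex.ofReal_zero, zero_mul, Complex.exp_zero, mul_one,
        mul_neg] at this
      push_cast
      rw [sub_eq_add_neg (x : ℂ), ← this]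
      refine intervalIntegral.integral_congr fun φ _ => ?_
      have hne : (ε : ℂ) * Complex.exp (φ * Complex.I) ≠ 0 :=
        mul_ne_zero (by exact_mod_cast hε.ne') (Complex.exp_ne_zero _)
      simp only [hg, hilbertKernel, add_sub_cancel_left]
      generalize (ε : ℂ) * Complex.exp (φ * Complex.I) = w at hne
      field_simp
    · refine ⟨⟨?_, ?_⟩, fun h => ?_⟩
      · rw [Complex.add_re, ofReal_mul_cexp_re, Complex.ofReal_re]
        nlinarith [Real.neg_one_le_cos φ]
      · rw [Complex.add_im, ofReal_mul_cexp_im, Complex.ofReal_im, zero_add]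
        exact mul_nonneg hε.le (Real.sin_nonneg_of_nonneg_of_le_pi hφ.1 hφ.2)
      · have h0 : (ε : ℂ) * Complex.exp (φ * Complex.I) = 0 := by simpa using h
        exact mul_ne_zero (by exact_mod_cast hε.ne') (Complex.exp_ne_zero _) h0
  -- limits of the primitive at `0` and at `∞` along the ray, and then along the real axis
  have hint1 : IntegrableOn (fun s : ℝ => g (s * κ) * κ) (Icc 0 1) :=
    by
    rw [integrableOn_Icc_iff_integrableOn_Ioc]
    exact hint.mono_set Ioc_subset_Ioi_self
  have hint2 : IntegrableOn (fun s : ℝ => g (s * κ) * κ) (Ioi 1) :=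
    hint.mono_set (Ioi_subset_Ioi zero_le_one)
  have hJ_split : (∫ s in (0 : ℝ)..1, g (s * κ) * κ) + ∫ s in Ioi (1 : ℝ), g (s * κ) * κ = J :=
    intervalIntegral.integral_interval_add_Ioi hint hint2
  have hP0ray : Tendsto (fun r : ℝ => P (r * κ)) (𝓝[>] 0)
      (𝓝 (P κ - ∫ s in (0 : ℝ)..1, g (s * κ) * κ)) := by
    refine (tendsto_const_nhds.sub (tendsto_integral_left one_pos hint1)).congr' ?_
    filter_upwards [Ioo_mem_nhdsGT one_pos] with r hr
    rw [hray r 1 hr.1 hr.2.le]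
    simp
  have hPinfray : Tendsto (fun r : ℝ => P (r * κ)) atTop
      (𝓝 (P κ + ∫ s in Ioi (1 : ℝ), g (s * κ) * κ)) := by
    refine (tendsto_const_nhds.add (intervalIntegral_tendsto_integral_Ioi 1 hint2
      tendsto_id)).congr' ?_
    filter_upwards [eventually_ge_atTop 1] with r hr
    rw [id, hray 1 r one_pos hr]
    simp
  have hP0 : Tendsto (fun r : ℝ => P r) (𝓝[>] 0)
      (𝓝 (P κ - ∫ s in (0 : ℝ)..1, g (s * κ) * κ)) := by
    have h1 := hP0ray.sub (tendsto_small_arc (ω := ω) (by linarith) hC hD hα hsmall hx)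
    rw [sub_zero] at h1
    refine h1.congr' ?_
    filter_upwards [Ioo_mem_nhdsGT hx] with r hr
    rw [harc r hr.1 hr.2.ne]
    ring
  have hPinf : Tendsto (fun r : ℝ => P r) atTop
      (𝓝 (P κ + ∫ s in Ioi (1 : ℝ), g (s * κ) * κ)) := by
    have h1 := hPinfray.sub (tendsto_large_arc (ω := ω) hM hδ hω hbound hx)
    rw [sub_zero] at h1
    refine h1.congr' ?_
    filter_upwards [eventually_gt_atTop x] with r hr
    rw [harc r (hx.trans hr) hr.ne']
    ring
  set p₀ : ℂ := P κ - ∫ s in (0 : ℝ)..1, g (s * κ) * κ with hp₀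
  have hleft : ∀ ε : ℝ, 0 < ε → ε < x →
      ∫ t in (0 : ℝ)..(x - ε), oscillatory f ω t / ((t : ℂ) - (x : ℂ)) =
        P ((x - ε : ℝ) : ℂ) - p₀ := by
    intro ε hε hεx
    have hi : IntegrableOn (fun t : ℝ => oscillatory f ω t / ((t : ℂ) - (x : ℂ)))
        (Icc 0 (x - ε)) := by
      have h1 := (hf_int.integrableOn_compact_subset (t := Icc 0 (x - ε)) Icc_subset_Ici_self
        isCompact_Icc).mul_continuousOn (g' := fun t : ℝ =>
          Complex.exp (Complex.I * ω * t) / ((t : ℂ) - (x : ℂ))) ?_ isCompact_Icc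
      · refine h1.congr_fun (fun t _ => ?_) measurableSet_Icc
        simp only [oscillatory]
        ring
      · refine ContinuousOn.div (by fun_prop) (by fun_prop) fun t ht => ?_
        rw [sub_ne_zero]
        exact_mod_cast (lt_of_le_of_lt ht.2 (by linarith)).ne
    refine tendsto_nhds_unique (tendsto_integral_left (by linarith) hi)
      ((tendsto_const_nhds.sub hP0).congr' ?_)
    filter_upwards [Ioo_mem_nhdsGT (show 0 < x - ε by linarith)] with r hr
    rw [hreal r (x - ε) hr.2.le fun t ht => ⟨hr.1.trans_le ht.1, ?_⟩]
    exact (lt_of_le_of_lt ht.2 (by linarith)).ne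
  have hhalf_lim : Tendsto (fun ε : ℝ => P ((x - ε : ℝ) : ℂ) - P ((x + ε : ℝ) : ℂ)) (𝓝[>] 0)
      (𝓝 (Complex.I * Real.pi * Complex.exp (Complex.I * ω * x) * f x)) := by
    have hcont : ContinuousOn (fun p : ℝ × ℝ =>
        Complex.I * (boundaryExtension F f (x + p.2 * Complex.exp (p.1 * Complex.I)) *
          Complex.exp (Complex.I * ω * (x + p.2 * Complex.exp (p.1 * Complex.I)))))
        (Icc 0 Real.pi ×ˢ Icc 0 (x / 2)) := by
      refine continuousOn_const.mul (ContinuousOn.mul ?_ (by fun_prop))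
      refine (continuousOn_boundaryExtension hf hF).comp (by fun_prop) fun p hp => ⟨?_, ?_⟩
      · rw [Complex.add_re, ofReal_mul_cexp_re, Complex.ofReal_re]
        nlinarith [Real.neg_one_le_cos p.1, hp.2.1, hp.2.2]
      · rw [Complex.add_im, ofReal_mul_cexp_im, Complex.ofReal_im, zero_add]
        exact mul_nonneg hp.2.1 (Real.sin_nonneg_of_nonneg_of_le_pi hp.1.1 hp.1.2)
    have h1 := tendsto_integral_of_continuousOn_prod hpi.le (by positivity) hcont
    have h2 : (∫ s in (0 : ℝ)..Real.pi, Complex.I *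
        (boundaryExtension F f (x + ((0 : ℝ) : ℂ) * Complex.exp (s * Complex.I)) *
          Complex.exp (Complex.I * ω * (x + ((0 : ℝ) : ℂ) * Complex.exp (s * Complex.I))))) =
        Complex.I * Real.pi * Complex.exp (Complex.I * ω * x) * f x := by
      simp only [Complex.ofReal_zero, zero_mul, add_zero, boundaryExtension_ofReal,
        intervalIntegral.integral_const, sub_zero, Complex.real_smul]
      ring
    rw [h2] at h1
    refine h1.congr' ?_
    filter_upwards [Ioo_mem_nhdsGT hx] with ε hε
    exact hhalf ε hε.1 hε.2
  have hsum : Tendsto (fun p : ℝ × ℝ => (P ((x - p.1 : ℝ) : ℂ) - P ((x + p.1 : ℝ) : ℂ)) +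
      (P p.2 - p₀)) (𝓝[>] (0 : ℝ) ×ˢ atTop)
      (𝓝 (Complex.I * Real.pi * Complex.exp (Complex.I * ω * x) * f x + J)) := by
    refine (hhalf_lim.comp tendsto_fst).add ?_
    have h1 := (hPinf.comp (tendsto_snd (f := 𝓝[>] (0 : ℝ)))).sub_const p₀
    have h2 : (P κ + ∫ s in Ioi (1 : ℝ), g (s * κ) * κ) - p₀ = J := by
      rw [hp₀, ← hJ_split]; ring
    rwa [h2] at h1
  refine hsum.congr' ?_
  have hev1 : ∀ᶠ p : ℝ × ℝ in 𝓝[>] (0 : ℝ) ×ˢ atTop, p.1 ∈ Ioo 0 x :=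
    tendsto_fst.eventually (Ioo_mem_nhdsGT hx)
  have hev2 : ∀ᶠ p : ℝ × ℝ in 𝓝[>] (0 : ℝ) ×ˢ atTop, 2 * x ≤ p.2 :=
    tendsto_snd.eventually (eventually_ge_atTop (2 * x))
  filter_upwards [hev1, hev2] with p hp1 hp2
  rw [truncatedHilbert, hleft _ hp1.1 hp1.2, hreal (x + p.1) p.2 (by linarith [hp1.2])
    fun t ht => ⟨by linarith [ht.1, hp1.1], (lt_of_lt_of_le (by linarith [hp1.1]) ht.1).ne'⟩]
  ring

end Kernel

/-! ### Watson's lemma on the ray -/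

/-- The power `z ^ p` on the ray `z = s e ^ (iπ/6)`, times `e ^ (iωz) dz / ds`. -/
noncomputable def rayMonomial (p ω s : ℝ) : ℂ :=
  Complex.exp (p * (Real.log s + (Real.pi / 6 : ℝ) * Complex.I)) *
    Complex.exp (Complex.I * ω * (s * Complex.exp ((Real.pi / 6 : ℝ) * Complex.I))) *
      Complex.exp ((Real.pi / 6 : ℝ) * Complex.I)

theorem norm_rayMonomial (p ω : ℝ) {s : ℝ} (hs : 0 < s) :
    ‖rayMonomial p ω s‖ = s ^ p * Real.exp (-(ω / 2) * s) := by
  rw [rayMonomial, norm_mul, norm_mul, Complex.norm_exp_ofReal_mul_I, mul_one, norm_cexp_I_mul,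
    ofReal_mul_cexp_im, Real.sin_pi_div_six, Complex.norm_exp, Complex.re_ofReal_mul,
    Complex.add_re, Complex.re_ofReal_mul, Complex.I_re, mul_zero, add_zero, Complex.ofReal_re,
    Real.rpow_def_of_pos hs, mul_comm p]
  ring_nf

theorem rayMonomial_eq (p ω : ℝ) {s : ℝ} (hs : 0 < s) :
    rayMonomial p ω s = Complex.exp (((p + 1 : ℝ) : ℂ) * ((Real.pi / 6 : ℝ) * Complex.I)) *
      (((s ^ (p + 1 - 1) : ℝ) : ℂ) *
        Complex.exp (-(-(Complex.I * ω * Complex.exp ((Real.pi / 6 : ℝ) * Complex.I)) * s))) := by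
  rw [add_sub_cancel_right, Real.rpow_def_of_pos hs, Complex.ofReal_exp, rayMonomial,
    ← Complex.exp_add, ← Complex.exp_add, ← Complex.exp_add, ← Complex.exp_add]
  congr 1
  push_cast
  ring

theorem integrableOn_rayMonomial {p ω : ℝ} (hp : -1 < p) (hω : 0 < ω) :
    IntegrableOn (rayMonomial p ω) (Ioi 0) := by
  have h := integrableOn_rpow_mul_exp_neg_mul_rpow (p := 1) (s := p) (b := ω / 2) hp one_pos
    (by positivity)
  refine h.mono' ?_ ?_
  · refine ContinuousOn.aestronglyMeasurable ?_ measurableSet_Ioi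
    unfold rayMonomial
    refine ContinuousOn.mul (ContinuousOn.mul ?_ (by fun_prop)) continuousOn_const
    refine (continuousOn_const.mul (ContinuousOn.add ?_ continuousOn_const)).cexp
    exact Complex.continuous_ofReal.comp_continuousOn
      (Real.continuousOn_log.mono fun s hs => ne_of_gt hs)
  · refine (ae_restrict_iff' measurableSet_Ioi).2 (Eventually.of_forall fun s hs => ?_)
    rw [norm_rayMonomial p ω hs, Real.rpow_one]

theorem integral_rayMonomial {p ω : ℝ} (hp : -1 < p) (hω : 0 < ω) :
    ∫ s in Ioi (0 : ℝ), rayMonomial p ω s =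
      Real.Gamma (p + 1) * Complex.exp (Real.pi / 2 * ((p + 1 : ℝ) : ℂ) * Complex.I) *
        ((ω ^ (-(p + 1)) : ℝ) : ℂ) := by
  have hpi := Real.pi_pos
  -- `e ^ (iωz) = e ^ (-rs)` on the ray, with `r = ω e ^ (-iπ/3)`
  have hr : -(Complex.I * ω * Complex.exp ((Real.pi / 6 : ℝ) * Complex.I)) =
      Complex.exp (Real.log ω + ((-(Real.pi / 3) : ℝ) : ℂ) * Complex.I) := by
    have h1 : Complex.exp (((-(Real.pi / 2) : ℝ) : ℂ) * Complex.I) = -Complex.I := by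
      rw [show (((-(Real.pi / 2) : ℝ) : ℂ) * Complex.I) = -Real.pi / 2 * Complex.I by
        push_cast; ring, Complex.exp_neg_pi_div_two_mul_I]
    have h2 : (((-(Real.pi / 3) : ℝ) : ℂ) * Complex.I) =
        ((-(Real.pi / 2) : ℝ) : ℂ) * Complex.I + (Real.pi / 6 : ℝ) * Complex.I := by
      push_cast; ring
    rw [Complex.exp_add, ← Complex.ofReal_exp, Real.exp_log hω, h2, Complex.exp_add, h1]
    ring
  have hre : 0 < (Complex.exp (Real.log ω + ((-(Real.pi / 3) : ℝ) : ℂ) * Complex.I)).re := by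
    rw [← ofReal_mul_cexp_eq hω, ofReal_mul_cexp_re, Real.cos_neg, Real.cos_pi_div_three]
    linarith
  have him : ((Real.log ω : ℂ) + ((-(Real.pi / 3) : ℝ) : ℂ) * Complex.I).im =
      -(Real.pi / 3) := by
    rw [Complex.add_im, Complex.im_ofReal_mul, Complex.ofReal_im, Complex.I_im]; ring
  rw [setIntegral_congr_fun measurableSet_Ioi fun s hs => rayMonomial_eq p ω hs,
    integral_const_mul, hr, integral_rpow_mul_cexp_neg_mul (by linarith) hre,
    Complex.cpow_def_of_ne_zero (Complex.exp_ne_zero _), Complex.log_exp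
      (by rw [him]; linarith) (by rw [him]; linarith),
    Real.rpow_def_of_pos hω, Complex.ofReal_exp, ← mul_assoc, ← Complex.exp_add, mul_assoc,
    ← Complex.exp_add, mul_comm]
  congr 2
  push_cast
  ring

/-- Multiplication by `z - x` telescopes the truncated expansion of `-F(z) / (z - x)`. -/
theorem sub_mul_sum_antidiagonal (a : ℕ → ℂ) {x : ℂ} (hx : x ≠ 0) (z : ℂ) (N : ℕ) :
    (z - x) * ∑ l ∈ Finset.range (N + 1),
        (∑ jk ∈ Finset.HasAntidiagonal.antidiagonal l, a jk.1 / x ^ (jk.2 + 1)) * z ^ l =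
      (∑ jk ∈ Finset.HasAntidiagonal.antidiagonal N, a jk.1 / x ^ (jk.2 + 1)) * z ^ (N + 1) -
        ∑ j ∈ Finset.range (N + 1), a j * z ^ j := by
  induction N with
  | zero =>
    simp
    field_simp
  | succ N ih =>
    have hrec : x * ∑ jk ∈ Finset.HasAntidiagonal.antidiagonal (N + 1), a jk.1 / x ^ (jk.2 + 1) =
        a (N + 1) +
          ∑ jk ∈ Finset.HasAntidiagonal.antidiagonal N, a jk.1 / x ^ (jk.2 + 1) := by
      rw [Finset.Nat.antidiagonal_succ', Finset.sum_cons, Finset.sum_map, mul_add, Finset.mul_sum]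
      congr 1
      · simp; field_simp
      · refine Finset.sum_congr rfl fun jk _ => ?_
        simp
        field_simp
        ring
    rw [Finset.sum_range_succ, mul_add, ih, Finset.sum_range_succ _ (N + 1)]
    linear_combination -(z ^ (N + 1)) * hrec

section Watson

variable {F : ℂ → ℂ} {f : ℝ → ℂ} {x : ℝ}

/-- The remainder of the expansion of the integrand on the ray. Since `|e ^ (iωz)| = e ^ (-ωs / 2)`
there, the growth `e ^ (D s)` of the remainder of `F` is absorbed for large `ω`. -/
theorem norm_ray_add_sum_le {α C D : ℝ} (a : ℕ → ℂ) (hx : 0 < x) (hC : 0 ≤ C) (hD : 0 ≤ D)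
    {N : ℕ} (hrem : ∀ ζ : ℂ, 0 ≤ ζ.im → ζ.im ≤ Real.pi / 6 →
      ‖boundaryExtension F f (Complex.exp ζ) -
          ∑ j ∈ Finset.range (N + 1), a j * Complex.exp (((j : ℂ) - α) * ζ)‖ ≤
        C * Real.exp (((N : ℝ) + 1 - α) * ζ.re + D * Real.exp ζ.re)) (ω : ℝ) {s : ℝ} (hs : 0 < s) :
    ‖hilbertKernel F f ω x (s * Complex.exp ((Real.pi / 6 : ℝ) * Complex.I)) *
        Complex.exp ((Real.pi / 6 : ℝ) * Complex.I) +
      ∑ l ∈ Finset.range (N + 1),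
        (∑ jk ∈ Finset.HasAntidiagonal.antidiagonal l, a jk.1 / (x : ℂ) ^ (jk.2 + 1)) *
          rayMonomial ((l : ℝ) - α) ω s‖ ≤
      (C + ‖∑ jk ∈ Finset.HasAntidiagonal.antidiagonal N, a jk.1 / (x : ℂ) ^ (jk.2 + 1)‖) /
        (x / 2) * (s ^ ((N : ℝ) + 1 - α) * Real.exp (-(ω / 2 - D) * s)) := by
  have hpi := Real.pi_pos
  set c : ℕ → ℂ := fun l =>
    ∑ jk ∈ Finset.HasAntidiagonal.antidiagonal l, a jk.1 / (x : ℂ) ^ (jk.2 + 1) with hc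
  set ζ : ℂ := Real.log s + (Real.pi / 6 : ℝ) * Complex.I with hζ
  set κ : ℂ := Complex.exp ((Real.pi / 6 : ℝ) * Complex.I) with hκ
  set z : ℂ := s * κ with hz
  set E : ℂ := Complex.exp (Complex.I * ω * z) with hE
  have hzζ : z = Complex.exp ζ := ofReal_mul_cexp_eq hs _
  have hζre : ζ.re = Real.log s := by
    rw [hζ, Complex.add_re, Complex.re_ofReal_mul, Complex.I_re, Complex.ofReal_re]; ring
  have hζim : ζ.im = Real.pi / 6 := by
    rw [hζ, Complex.add_im, Complex.im_ofReal_mul, Complex.I_im, Complex.ofReal_im]; ring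
  have hzim : z.im = s / 2 := by
    rw [hz, ofReal_mul_cexp_im, Real.sin_pi_div_six]; ring
  -- the ray keeps the distance `x sin (π / 6)` from `x`
  have hden : x / 2 ≤ ‖z - x‖ := by
    have h1 : ‖z - x‖ = ‖(s : ℂ) - x * Complex.exp ((-(Real.pi / 6) : ℝ) * Complex.I)‖ := by
      have h2 : z - x = κ * (s - x * Complex.exp ((-(Real.pi / 6) : ℝ) * Complex.I)) := by
        have h3 : κ * Complex.exp ((-(Real.pi / 6) : ℝ) * Complex.I) = 1 := by
          rw [hκ, ← Complex.exp_add, ← Complex.exp_zero]; congr 1; push_cast; ring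
        linear_combination hz + x * h3
      rw [h2, norm_mul, hκ, Complex.norm_exp_ofReal_mul_I, one_mul]
    rw [h1]
    refine le_trans ?_ (Complex.abs_im_le_norm _)
    rw [Complex.sub_im, ofReal_mul_cexp_im, Real.sin_neg, Real.sin_pi_div_six, Complex.ofReal_im]
    refine le_trans (le_of_eq ?_) (le_abs_self _)
    ring
  have hzx : z - x ≠ 0 := norm_pos_iff.1 (lt_of_lt_of_le (by positivity) hden)
  have hpow : ∀ j : ℕ, Complex.exp (((j : ℂ) - α) * ζ) = z ^ j * Complex.exp (-α * ζ) := by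
    intro j
    rw [hzζ, ← Complex.exp_nat_mul, ← Complex.exp_add]
    congr 1
    ring
  have hmono : ∀ l : ℕ, rayMonomial ((l : ℝ) - α) ω s = z ^ l * Complex.exp (-α * ζ) * E * κ := by
    intro l
    rw [← hpow, rayMonomial, Complex.ofReal_sub, Complex.ofReal_natCast]
  -- the telescoped form leaves only the remainder of the expansion of `F` and the last power
  have hkey : hilbertKernel F f ω x z * κ + ∑ l ∈ Finset.range (N + 1),
        c l * rayMonomial ((l : ℝ) - α) ω s =
      ((boundaryExtension F f z -
          ∑ j ∈ Finset.range (N + 1), a j * Complex.exp (((j : ℂ) - α) * ζ)) +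
        c N * (z ^ (N + 1) * Complex.exp (-α * ζ))) / (z - x) * (E * κ) := by
    have hx' : (x : ℂ) ≠ 0 := by exact_mod_cast hx.ne'
    have ht := sub_mul_sum_antidiagonal a hx' z N
    have h1 : ∑ l ∈ Finset.range (N + 1), c l * rayMonomial ((l : ℝ) - α) ω s =
        (∑ l ∈ Finset.range (N + 1), c l * z ^ l) * (Complex.exp (-α * ζ) * E * κ) := by
      rw [Finset.sum_mul]
      exact Finset.sum_congr rfl fun l _ => by rw [hmono]; ring
    have h2 : ∑ j ∈ Finset.range (N + 1), a j * Complex.exp (((j : ℂ) - α) * ζ) =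
        (∑ j ∈ Finset.range (N + 1), a j * z ^ j) * Complex.exp (-α * ζ) := by
      rw [Finset.sum_mul]
      exact Finset.sum_congr rfl fun l _ => by rw [hpow]; ring
    rw [h1, h2, hilbertKernel, ← hE]
    rw [div_mul_eq_mul_div, div_mul_eq_mul_div, div_add' _ _ _ hzx]
    congr 1
    linear_combination (Complex.exp (-α * ζ) * E * κ) * ht
  have hlast : ‖c N * (z ^ (N + 1) * Complex.exp (-α * ζ))‖ = ‖c N‖ * s ^ ((N : ℝ) + 1 - α) := by
    rw [← hpow, norm_mul, norm_cexp_sub_mul, hζre, Real.rpow_def_of_pos hs]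
    push_cast
    rw [mul_comm (Real.log s)]
  have hfirst := hrem ζ (by rw [hζim]; positivity) hζim.le
  rw [← hzζ, hζre, Real.exp_log hs, Real.exp_add, mul_comm _ (Real.log s),
    ← Real.rpow_def_of_pos hs] at hfirst
  have hED : 1 ≤ Real.exp (D * s) := Real.one_le_exp (by positivity)
  rw [hkey, norm_mul, norm_div, norm_mul E, hκ, Complex.norm_exp_ofReal_mul_I, mul_one, hE,
    norm_cexp_I_mul, hzim]
  have hnum : ‖(boundaryExtension F f z -
          ∑ j ∈ Finset.range (N + 1), a j * Complex.exp (((j : ℂ) - α) * ζ)) +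
        c N * (z ^ (N + 1) * Complex.exp (-α * ζ))‖ ≤
      (C + ‖c N‖) * (s ^ ((N : ℝ) + 1 - α) * Real.exp (D * s)) := by
    refine (norm_add_le _ _).trans ?_
    rw [add_mul, hlast]
    refine add_le_add hfirst (mul_le_mul_of_nonneg_left ?_ (norm_nonneg _))
    exact le_mul_of_one_le_right (by positivity) hED
  calc _ ≤ (C + ‖c N‖) * (s ^ ((N : ℝ) + 1 - α) * Real.exp (D * s)) / (x / 2) *
        Real.exp (-(ω * (s / 2))) := by gcongr
    _ = (C + ‖c N‖) / (x / 2) * (s ^ ((N : ℝ) + 1 - α) *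
        (Real.exp (D * s) * Real.exp (-(ω * (s / 2))))) := by ring
    _ = _ := by
      rw [← Real.exp_add, show D * s + -(ω * (s / 2)) = -(ω / 2 - D) * s by ring]

/-- Watson's lemma for the integral over the ray. -/
theorem isLittleO_ray_integral {α C D ω₀ : ℝ} (a : ℕ → ℂ) (hα : α < 1) (hx : 0 < x) (hC : 0 ≤ C)
    (hD : 0 ≤ D) {N : ℕ} (hrem : ∀ ζ : ℂ, 0 ≤ ζ.im → ζ.im ≤ Real.pi / 6 →
      ‖boundaryExtension F f (Complex.exp ζ) -
          ∑ j ∈ Finset.range (N + 1), a j * Complex.exp (((j : ℂ) - α) * ζ)‖ ≤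
        C * Real.exp (((N : ℝ) + 1 - α) * ζ.re + D * Real.exp ζ.re))
    (hint : ∀ ω : ℝ, ω₀ < ω → IntegrableOn (fun s : ℝ =>
      hilbertKernel F f ω x (s * Complex.exp ((Real.pi / 6 : ℝ) * Complex.I)) *
        Complex.exp ((Real.pi / 6 : ℝ) * Complex.I)) (Ioi 0)) :
    (fun ω : ℝ => (∫ s in Ioi (0 : ℝ),
        hilbertKernel F f ω x (s * Complex.exp ((Real.pi / 6 : ℝ) * Complex.I)) *
          Complex.exp ((Real.pi / 6 : ℝ) * Complex.I)) +
      ∑ l ∈ Finset.range (N + 1),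
        (∑ jk ∈ Finset.HasAntidiagonal.antidiagonal l, a jk.1 / (x : ℂ) ^ (jk.2 + 1)) *
          ∫ s in Ioi (0 : ℝ), rayMonomial ((l : ℝ) - α) ω s)
      =o[atTop] fun ω => ω ^ (-((N : ℝ) + 1 - α)) := by
  set c : ℕ → ℂ := fun l =>
    ∑ jk ∈ Finset.HasAntidiagonal.antidiagonal l, a jk.1 / (x : ℂ) ^ (jk.2 + 1) with hc
  set A : ℝ := (C + ‖c N‖) / (x / 2) with hA
  have hA0 : 0 ≤ A := by positivity
  set b : ℝ := (N : ℝ) + 1 - α + 1 with hb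
  have hN : (0 : ℝ) ≤ N := N.cast_nonneg
  have hb0 : 0 < b := by rw [hb]; linarith
  have hG : 0 < Real.Gamma b := Real.Gamma_pos_of_pos hb0
  -- the remainder bound `s ^ (b - 1) e ^ (-(ω / 2 - D) s)` integrates to a Gamma function, which
  -- gains one power of `ω` over the last term
  have hO : (fun ω : ℝ => (∫ s in Ioi (0 : ℝ),
        hilbertKernel F f ω x (s * Complex.exp ((Real.pi / 6 : ℝ) * Complex.I)) *
          Complex.exp ((Real.pi / 6 : ℝ) * Complex.I)) +
      ∑ l ∈ Finset.range (N + 1), c l * ∫ s in Ioi (0 : ℝ), rayMonomial ((l : ℝ) - α) ω s)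
      =O[atTop] fun ω => ω ^ (-b) := by
    refine IsBigO.of_bound (A * Real.Gamma b * 4 ^ b) ?_
    filter_upwards [eventually_gt_atTop ω₀, eventually_ge_atTop (4 * D), eventually_gt_atTop 0]
      with ω hω₀ hωD hω
    have hmono : ∀ l : ℕ, IntegrableOn (rayMonomial ((l : ℝ) - α) ω) (Ioi 0) := fun l =>
      integrableOn_rayMonomial (by have : (0 : ℝ) ≤ l := l.cast_nonneg; linarith) hω
    have hδ : 0 < ω / 2 - D := by linarith
    have hsum : ∑ l ∈ Finset.range (N + 1), c l * ∫ s in Ioi (0 : ℝ),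
        rayMonomial ((l : ℝ) - α) ω s = ∫ s in Ioi (0 : ℝ), ∑ l ∈ Finset.range (N + 1),
          c l * rayMonomial ((l : ℝ) - α) ω s := by
      rw [integral_finsetSum _ fun l _ => (hmono l).const_mul _]
      exact Finset.sum_congr rfl fun l _ => (integral_const_mul _ _).symm
    rw [hsum, ← integral_add (hint ω hω₀)
      (integrable_finsetSum _ fun l _ => (hmono l).const_mul _)]
    have hbi : IntegrableOn (fun s : ℝ => A * (s ^ ((N : ℝ) + 1 - α) *
        Real.exp (-(ω / 2 - D) * s))) (Ioi 0) := by
      have := integrableOn_rpow_mul_exp_neg_mul_rpow (p := 1) (s := (N : ℝ) + 1 - α)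
        (by linarith) one_pos hδ
      simp only [Real.rpow_one] at this
      exact this.const_mul A
    refine (norm_integral_le_of_norm_le hbi ((ae_restrict_iff' measurableSet_Ioi).2
      (Eventually.of_forall fun s hs => norm_ray_add_sum_le a hx hC hD hrem ω hs))).trans ?_
    have hval := Real.integral_rpow_mul_exp_neg_mul_Ioi hb0 hδ
    rw [hb, add_sub_cancel_right, ← hb] at hval
    rw [integral_const_mul]
    simp only [neg_mul]
    rw [hval, Real.norm_of_nonneg (Real.rpow_nonneg hω.le _)]
    have h4 : (1 / (ω / 2 - D)) ^ b ≤ 4 ^ b * ω ^ (-b) := by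
      rw [Real.rpow_neg hω.le, ← Real.inv_rpow hω.le, ← Real.mul_rpow (by norm_num) (by positivity)]
      refine Real.rpow_le_rpow (by positivity) ?_ hb0.le
      rw [div_le_iff₀ hδ]
      have : 4 * ω⁻¹ * (ω / 2 - D) = 2 - 4 * D / ω := by field_simp; ring
      rw [this]
      have : 4 * D / ω ≤ 1 := (div_le_one hω).2 hωD
      linarith
    calc A * ((1 / (ω / 2 - D)) ^ b * Real.Gamma b)
        ≤ A * (4 ^ b * ω ^ (-b) * Real.Gamma b) := by gcongr
      _ = _ := by ring
  refine hO.trans_isLittleO ?_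
  have h1 : (fun ω : ℝ => ω ^ (-b)) =ᶠ[atTop]
      fun ω => ω ^ (-(1 : ℝ)) * ω ^ (-((N : ℝ) + 1 - α)) := by
    filter_upwards [eventually_gt_atTop 0] with ω hω
    rw [← Real.rpow_add hω, hb]
    ring_nf
  have h2 : (fun ω : ℝ => ω ^ (-(1 : ℝ))) =o[atTop] fun _ => (1 : ℝ) :=
    (isLittleO_one_iff ℝ).2 (tendsto_rpow_neg_atTop one_pos)
  refine h1.trans_isLittleO ?_
  simpa using h2.mul_isBigO (isBigO_refl (fun ω : ℝ => ω ^ (-((N : ℝ) + 1 - α))) atTop)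

end Watson

/-! ### The asymptotic expansion of the Hilbert transform -/

theorem mainTheorem1 (f : ℝ → ℂ) (F : ℂ → ℂ) (M δ d α : ℝ) (a : ℕ → ℂ)
    (hf_int : LocallyIntegrableOn f (Ici 0))
    (hf_diff : ContDiffOn ℝ 1 f (Ioi 0))
    (hF : IsContinuationToFirstQuadrant F f)
    (hF_zero : HasAlgebraicGrowthAtOrigin F)
    (hM : 0 < M) (hδ : δ < 1) (hd : 0 ≤ d)
    (hF_growth : ∃ R : ℝ, ∀ z ∈ firstQuadrant, R ≤ ‖z‖ →
      ‖F z‖ ≤ M * ‖z‖ ^ δ * Real.exp (d * z.im))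
    (hα_nonneg : 0 ≤ α) (hα_lt : α < 1)
    (hf_asymp : HasAsymptoticExpansion f a (fun j t => t ^ ((j : ℝ) - α)) (𝓝[>] 0))
    (x : ℝ) (hx : 0 < x) :
    (∀ ω : ℝ, d < ω →
      HasOneSidedHilbert (oscillatory f ω) x (oneSidedHilbert (oscillatory f ω) x)) ∧
    HasAsymptoticExpansion
      (fun ω => oneSidedHilbert (oscillatory f ω) x -
        Complex.I * (Real.pi : ℂ) * Complex.exp (Complex.I * (ω : ℂ) * (x : ℂ)) * f x)
      (fun l => -((Real.Gamma ((l : ℝ) + 1 - α) : ℂ) *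
        Complex.exp ((Real.pi : ℂ) / 2 * (((l : ℝ) + 1 - α : ℝ) : ℂ) * Complex.I) *
        ∑ jk ∈ Finset.HasAntidiagonal.antidiagonal l, a jk.1 / (x : ℂ) ^ (jk.2 + 1)))
      (fun l ω => ω ^ (-((l : ℝ) + 1 - α)))
      atTop := by
  have hpi := Real.pi_pos
  have hf : ContinuousOn f (Ioi 0) := hf_diff.continuousOn
  have hrem := exists_remainder_bound hf hF
    (exists_growth_bound hf hF hF_zero hM hd hF_growth (by linarith)) hα_nonneg hα_lt hf_asymp
  -- the leading term of the expansion bounds `F` near the origin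
  obtain ⟨C, D, hC, hD, hsmall⟩ : ∃ C D : ℝ, 0 ≤ C ∧ 0 ≤ D ∧ ∀ ζ : ℂ, 0 ≤ ζ.im →
      ζ.im ≤ Real.pi / 6 → ‖boundaryExtension F f (Complex.exp ζ)‖ ≤
        C * Real.exp (-α * ζ.re + D * Real.exp ζ.re) := by
    obtain ⟨C, D, hC, hD, h⟩ := hrem 0
    refine ⟨C + ‖a 0‖, D + 1, by positivity, by positivity, fun ζ h0 h1 => ?_⟩
    have h2 := h ζ h0 h1
    have h3 := norm_sum_cexp_le a α (s := Finset.range 1) (q := -α) (D := D + 1)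
      (fun j hj => by simp) (fun j hj => by
        simp only [Finset.range_one, Finset.mem_singleton] at hj
        rw [hj]; push_cast; linarith) ζ
    rw [Finset.sum_range_one (fun j => ‖a j‖)] at h3
    have h4 := exp_add_mul_exp_mono (p := ((0 : ℕ) : ℝ) + 1 - α) (q := -α) (D := D) (D' := D + 1)
      (by push_cast; linarith) (by push_cast; linarith) ζ.re
    have h5 := norm_le_norm_sub_add (boundaryExtension F f (Complex.exp ζ))
      (∑ j ∈ Finset.range (0 + 1), a j * Complex.exp (((j : ℂ) - α) * ζ))
    rw [add_mul]
    exact h5.trans (add_le_add (h2.trans (mul_le_mul_of_nonneg_left h4 hC)) h3)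
  obtain ⟨R, hR⟩ := hF_growth
  have hbound := norm_boundaryExtension_le_of_growth hF hR
  have hH := fun (ω : ℝ) (hω : d < ω) =>
    hasOneSidedHilbert_ray hf_int hf hF hM hδ hd hω hbound hC hD hα_lt hsmall hx
  have hval := fun (ω : ℝ) (hω : d < ω) => (hH ω hω).limUnder_eq
  refine ⟨fun ω hω => ?_, fun N => ?_⟩
  · rw [oneSidedHilbert, hval ω hω]
    exact hH ω hω
  · obtain ⟨C', D', hC', hD', hrem'⟩ := hrem N
    refine (isLittleO_ray_integral (ω₀ := d) a hα_lt hx hC' hD' hrem' fun ω hω =>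
      integrableOn_ray hf hF hM hδ hd hω hbound hC hD hα_lt hsmall hx).congr' ?_ EventuallyEq.rfl
    filter_upwards [eventually_gt_atTop d, eventually_gt_atTop 0] with ω hω hω0
    rw [oneSidedHilbert, hval ω hω, add_sub_cancel_left, sub_eq_add_neg, ← Finset.sum_neg_distrib]
    congr 1
    refine Finset.sum_congr rfl fun l _ => ?_
    rw [integral_rayMonomial (by have : (0 : ℝ) ≤ l := l.cast_nonneg; linarith) hω0,
      show (l : ℝ) - α + 1 = (l : ℝ) + 1 - α by ring]
    ring
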